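/- Let $(Y_i)_{i\ge 1}$ be a time-homogeneous irreducible Markov chain with values in a finite alphabet $\Delta$ (with any initial distribution), and let $U=u_1\dots u_K$ and $D=d_1\dots d_M$ be non-empty words over $\Delta$, neither of which is a contiguous subword of the other, with $$P(Y_1=u_1,\dots,Y_K=u_K)>0,\qquad P(Y_1=d_1,\dots,Y_M=d_M)>0 .$$ Say that a word $w_1\dots w_L$ occurs at time $n$ if $n\ge L$ and $Y_{n-L+1}=w_1,\dots,Y_n=w_L$. Let $S_n$ be the number of times $i\in\{1,\dots,n\}$ at which $U$ occurs minus the number of times $i\in\{1,\dots,n\}$ at which $D$ occurs. For integers $A,B>0$ let $$\tau=\min\{n\ge 1: S_n=A\text{ or }S_n=-B\},\qquad \alpha=P(\tau<\infty,\ S_\tau=A).$$ Let $\tau_1<\tau_2<\cdots$ be the successive times at which $U$ or $D$ occurs, put $\gamma_1=\tau_1$ and $\gamma_k=\tau_k-\tau_{k-1}$ for $k\ge 2$, and let $X_k=1$ if $U$ occurs at time $\tau_k$ and $X_k=-1$ if $D$ occurs at time $\tau_k$. Then $(X_k)_{k\ge1}$ is a time-homogeneous Markov chain on $\{1,-1\}$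 with transition probabilities $P(X_2=j\mid X_1=i)$. Let $$T=\min\{k\ge 1: X_1+\cdots+X_k=A\text{ or }X_1+\cdots+X_k=-B\}.$$ Assume that the chain with the transition matrix $\big(P(X_2=j\mid X_1=i)\big)_{i,j\in\{1,-1\}}$ is aperiodic. Then $P(X_1=1)>0$ and $P(X_1=-1)>0$, the expectations $E(\tau)$, $E(T)$, $E(\gamma_1)$, $E(\gamma_2\mid X_1=1)$ and $E(\gamma_2\mid X_1=-1)$ are finite, and $$E(\tau)=E(\gamma_1)+a\big[(A+B-2)\alpha-(B-1)\big]+b\big[E(T)-1\big],$$ where $$a=\tfrac12\big[E(\gamma_2\mid X_1=1)-E(\gamma_2\mid X_1=-1)\big],\qquad b=\tfrac12\big[E(\gamma_2\mid X_1=1)+E(\gamma_2\mid X_1=-1)\big].$$ -/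

import Mathlib

open MeasureTheory ProbabilityTheory
open scoped ENNReal

noncomputable section

namespace TwoWordGame

/-- `Y 0, Y 1, Y 2, …` is a time-homogeneous Markov chain under `μ` with finite state space `Δ` and
transition matrix `P` (and an arbitrary initial distribution). -/
structure IsMarkovChain {Ω Δ : Type*} [MeasurableSpace Ω] [Fintype Δ] [DecidableEq Δ]
    [MeasurableSpace Δ] (μ : Measure Ω) (P : Matrix Δ Δ ℝ) (Y : ℕ → Ω → Δ) : Prop where
  measurable : ∀ n, Measurable (Y n)
  stochastic : P ∈ Matrix.rowStochastic ℝ Δ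
  /-- `P(Y₀ = x₀, …, Yₙ₊₁ = xₙ₊₁) = P(Y₀ = x₀, …, Yₙ = xₙ) P(xₙ, xₙ₊₁)`. -/
  markov : ∀ (n : ℕ) (x : ℕ → Δ),
    μ.real {ω | ∀ i ≤ n + 1, Y i ω = x i} = μ.real {ω | ∀ i ≤ n, Y i ω = x i} * P (x n) (x (n + 1))

/-- Every state has period one: the only common divisor of the lengths `n ≥ 1` of possible
returns `i → i` is `1`. -/
def IsAperiodic {ι : Type*} [Fintype ι] [DecidableEq ι] (Q : Matrix ι ι ℝ) : Prop :=
  ∀ i, ∀ d : ℕ, (∀ n : ℕ, 1 ≤ n → 0 < (Q ^ n) i i → d ∣ n) → d = 1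

section Path

/-! Functionals of one infinite text `y`; its letters, in order, are `y 0, y 1, y 2, …`.
Time is counted by the number of letters read: at time `n` these are `y 0, …, y (n - 1)`. -/

variable {Δ : Type*}

/-- The word `w` is completed at time `n`: the last `w.length` of the first `n` letters
spell `w`. -/
def OccursAt (w : List Δ) (y : ℕ → Δ) (n : ℕ) : Prop :=
  w.length ≤ n ∧ ∀ j : Fin w.length, y (n - w.length + j) = w.get j

open Classical in
/-- The number `Sₙ` of points at time `n`. -/
def score (U D : List Δ) (y : ℕ → Δ) (n : ℕ) : ℤ :=
  ∑ i ∈ Finset.Icc 1 n,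
    ((if OccursAt U y i then 1 else 0) - (if OccursAt D y i then 1 else 0))

/-- The duration `τ` of the game, the first `n ≥ 1` with `Sₙ = A` or `Sₙ = -B`
(`⊤` if there is none). -/
def gameTime (U D : List Δ) (A B : ℤ) (y : ℕ → Δ) : ℕ∞ :=
  sInf {t | ∃ n : ℕ, t = n ∧ 1 ≤ n ∧ (score U D y n = A ∨ score U D y n = -B)}

/-- The time `τₖ` of the `k`-th occurrence of a word (`⊤` if there is none), with `τ₀ = 0`. -/
def wordTime (U D : List Δ) (y : ℕ → Δ) : ℕ → ℕ∞
  | 0 => 0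
  | k + 1 => sInf {t | ∃ n : ℕ, t = n ∧ wordTime U D y k < n ∧ (OccursAt U y n ∨ OccursAt D y n)}

/-- The waiting times `γ₁ = τ₁` and `γₖ = τₖ - τₖ₋₁` for `k ≥ 2`. -/
def waitTime (U D : List Δ) (y : ℕ → Δ) (k : ℕ) : ℕ∞ :=
  wordTime U D y k - wordTime U D y (k - 1)

open Classical in
/-- The sign `Xₖ`, `k ≥ 1`: it is `1` if the word that occurs at time `τₖ` is `U` and `-1` if it is
`D` (and `0` if `τₖ = ⊤`). -/
def wordSign (U D : List Δ) (y : ℕ → Δ) (k : ℕ) : ℤ :=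
  if ∃ n : ℕ, wordTime U D y k = n ∧ OccursAt U y n then 1
  else if ∃ n : ℕ, wordTime U D y k = n ∧ OccursAt D y n then -1
  else 0

/-- The ruin time `T` of the embedded walk, the first `k ≥ 1` with `X₁ + ⋯ + Xₖ = A` or
`X₁ + ⋯ + Xₖ = -B` (`⊤` if there is none). -/
def ruinTime (U D : List Δ) (A B : ℤ) (y : ℕ → Δ) : ℕ∞ :=
  sInf {t | ∃ k : ℕ, t = k ∧ 1 ≤ k ∧
    (∑ j ∈ Finset.Icc 1 k, wordSign U D y j = A ∨ ∑ j ∈ Finset.Icc 1 k, wordSign U D y j = -B)}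

end Path

section Law

variable {Ω Δ : Type*} [MeasurableSpace Ω]

/-- The expectation, in `[0, ∞]`, of a random time with values in `{0, 1, 2, …, ∞}`. -/
def expectedTime (μ : Measure Ω) (t : Ω → ℕ∞) : ℝ≥0∞ := ∫⁻ ω, (t ω : ℝ≥0∞) ∂μ

/-- The event `X₁ = s`. -/
def firstSign (Y : ℕ → Ω → Δ) (U D : List Δ) (s : ℤ) : Set Ω :=
  {ω | wordSign U D (fun i => Y i ω) 1 = s}

/-- The transition matrix `P(X₂ = j | X₁ = i)`, `i, j ∈ {1, -1} = ℤˣ`, of the embedded chain. -/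
def signMatrix (μ : Measure Ω) (Y : ℕ → Ω → Δ) (U D : List Δ) : Matrix ℤˣ ℤˣ ℝ :=
  fun i j => (μ[|firstSign Y U D i]).real {ω | wordSign U D (fun n => Y n ω) 2 = j}

/-- The probability `α = P(S_τ = A)` that the game stops (`τ < ∞`) with `A` points. -/
def winProb (μ : Measure Ω) (Y : ℕ → Ω → Δ) (U D : List Δ) (A B : ℤ) : ℝ :=
  μ.real {ω | ∃ n : ℕ, gameTime U D A B (fun i => Y i ω) = n ∧ score U D (fun i => Y i ω) n = A}

end Law

end TwoWordGame

end

/-! The score changes only at word times, by `±1`, and `S` at `τₖ` is `X₁ + ⋯ + Xₖ`. Hence `τ` is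
the word time of index `T`, that is, `τ = γ₁ + ∑_{1 ≤ k < T} γₖ₊₁`. The event `{k < T, Xₖ = s}` is
settled at time `τₖ`. By the renewal property (`renewal`, used in `lintegral_activeStep`) the next
wait has mean `m_s = E(γ₂ | X₁ = s)` on it. So `E τ = E γ₁ + c₁ m₁ + c₋₁ m₋₁`, where `c_s` is the
expected number of `k < T` with `Xₖ = s`.

Two linear relations give `c₁` and `c₋₁`. Their sum is `E T - 1`. Their difference is the mean of
the walk one step before ruin; there it stands at `A - 1` if it is about to win and at `-(B - 1)`
otherwise, so the difference is `(A + B - 2)α - (B - 1)`.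

Renewal rests on the words being unnested: a word completed after an occurrence of `w` cannot start
before that occurrence, since it would contain `w`. The future of the game therefore depends only on
the text from the first letter of `w` on (`Unnested.shift`), and by the Markov property the law of
what follows `w` depends only on its last letter.

All finiteness comes from `exists_tsum_le_of_escape`: if every state starts a path of positive
probability that leaves the survival events, their probabilities are summable. It is applied to `Y`,
where irreducibility leads to a completion of `U`, and to the chain of signs, where aperiodicity
gives a sign that can be repeated until the walk has left the interval. -/

noncomputable section

namespace TwoWordGame

/-! ### Events settled by finitely many letters -/

section Determined

variable {Δ : Type*}

/-- Membership in `G` depends only on the first `n` letters. -/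
def Determined (n : ℕ) (G : Set (ℕ → Δ)) : Prop :=
  ∀ y y' : ℕ → Δ, (∀ i < n, y i = y' i) → y ∈ G → y' ∈ G

lemma Determined.mono {n m : ℕ} {G : Set (ℕ → Δ)} (h : Determined n G) (hnm : n ≤ m) :
    Determined m G :=
  fun y y' hyy => h y y' fun i hi => hyy i (by omega)

lemma Determined.inter {n : ℕ} {G H : Set (ℕ → Δ)} (hG : Determined n G) (hH : Determined n H) :
    Determined n (G ∩ H) :=
  fun y y' hyy h => ⟨hG y y' hyy h.1, hH y y' hyy h.2⟩

/-- Such an event is pulled back from a subset of the finite discrete space `Fin n → Δ`. -/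
lemma Determined.measurableSet [Finite Δ] [MeasurableSpace Δ] [DiscreteMeasurableSpace Δ] {n : ℕ}
    {G : Set (ℕ → Δ)} (hG : Determined n G) : MeasurableSet G := by
  let f : (ℕ → Δ) → (Fin n → Δ) := fun y i => y i
  have hf : Measurable f := measurable_pi_lambda _ fun i => measurable_pi_apply _
  have : G = f ⁻¹' (f '' G) := by
    ext y
    refine ⟨fun h => ⟨y, h, rfl⟩, ?_⟩
    rintro ⟨y', hy', he⟩
    exact hG y' y (fun i hi => congrFun he ⟨i, hi⟩) hy'
  rw [this]
  exact hf (Set.toFinite _).measurableSet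

end Determined

/-! ### Cylinder sets of the path space -/

section Cylinders

variable {Δ : Type*}

/-- Cylinders form a π-system that generates the product σ-algebra. -/
lemma isPiSystem_cylinders :
    IsPiSystem {S : Set (ℕ → Δ) | ∃ (z : ℕ → Δ) (r : ℕ), S = {y | ∀ j ≤ r, y j = z j}} := by
  rintro _ ⟨z, r, rfl⟩ _ ⟨z', r', rfl⟩ ⟨x, hx, hx'⟩
  refine ⟨x, max r r', ?_⟩
  ext y
  simp only [Set.mem_inter_iff, Set.mem_ofPred_eq] at *
  constructor
  · rintro ⟨h, h'⟩ j hj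
    rcases le_max_iff.1 hj with hj | hj
    · rw [h j hj, hx j hj]
    · rw [h' j hj, hx' j hj]
  · intro h
    exact ⟨fun j hj => by rw [h j (le_max_of_le_left hj), hx j hj],
      fun j hj => by rw [h j (le_max_of_le_right hj), hx' j hj]⟩

lemma generateFrom_cylinders [Finite Δ] [MeasurableSpace Δ] [DiscreteMeasurableSpace Δ] :
    (MeasurableSpace.pi : MeasurableSpace (ℕ → Δ)) =
      MeasurableSpace.generateFrom {S | ∃ (z : ℕ → Δ) (r : ℕ), S = {y | ∀ j ≤ r, y j = z j}} := by
  apply le_antisymm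
  · refine iSup_le fun i => ?_
    rintro _ ⟨S, -, rfl⟩
    -- A finite union over the words of length `i + 1` with last letter in `S`; the filler `v.1 0`
    -- is never read.
    have : (fun y : ℕ → Δ => y i) ⁻¹' S = ⋃ v : {v : Fin (i + 1) → Δ // v (Fin.last i) ∈ S},
        {y | ∀ j ≤ i, y j = if h : j < i + 1 then v.1 ⟨j, h⟩ else v.1 0} := by
      ext y
      simp only [Set.mem_preimage, Set.mem_iUnion, Set.mem_ofPred_eq]
      constructor
      · intro h
        refine ⟨⟨fun j => y j, by simpa using h⟩, fun j hj => ?_⟩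
        simp [Nat.lt_succ_of_le hj]
      · rintro ⟨⟨v, hv⟩, h⟩
        have := h i le_rfl
        simp only [Nat.lt_succ_self, dite_true] at this
        rw [this]
        exact hv
    rw [this]
    exact MeasurableSet.iUnion fun v => MeasurableSpace.measurableSet_generateFrom ⟨_, _, rfl⟩
  · refine MeasurableSpace.generateFrom_le ?_
    rintro _ ⟨z, r, rfl⟩
    refine Determined.measurableSet (n := r + 1) fun y y' hyy h j hj => ?_
    rw [← hyy j (by omega)]
    exact h j hj

end Cylinders

/-! ### Markov property and escape estimate -/

section Markov

variable {Ω Δ : Type*} [MeasurableSpace Ω] {μ : Measure Ω}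
  [Fintype Δ] [DecidableEq Δ] [MeasurableSpace Δ] {P : Matrix Δ Δ ℝ} {Y : ℕ → Ω → Δ}

lemma IsMarkovChain.measurable_path (hY : IsMarkovChain μ P Y) :
    Measurable fun ω i => Y i ω :=
  measurable_pi_lambda _ hY.measurable

lemma IsMarkovChain.nonneg (hY : IsMarkovChain μ P Y) (i j : Δ) : 0 ≤ P i j :=
  Matrix.nonneg_of_mem_rowStochastic hY.stochastic

variable [IsProbabilityMeasure μ] [DiscreteMeasurableSpace Δ]

lemma IsMarkovChain.step (hY : IsMarkovChain μ P Y) {n : ℕ} {G : Set (ℕ → Δ)}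
    (hG : Determined (n + 1) G) (a b : Δ) :
    μ.real {ω | (fun i => Y i ω) ∈ G ∧ Y n ω = a ∧ Y (n + 1) ω = b} =
      μ.real {ω | (fun i => Y i ω) ∈ G ∧ Y n ω = a} * P a b := by
  let f : Ω → (Fin (n + 1) → Δ) := fun ω i => Y i ω
  have hf : Measurable f := measurable_pi_lambda _ fun i => hY.measurable _
  -- Splitting by the first `n + 1` letters reduces both sides to single cylinders, on which the
  -- defining product formula applies, or to the empty set.
  have key : ∀ S : Set Ω, μ.real S = ∑ v : Fin (n + 1) → Δ, μ.real (S ∩ f ⁻¹' {v}) := by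
    intro S
    have h := sum_measureReal_preimage_singleton (μ := μ.restrict S) (f := f)
      (Finset.univ : Finset (Fin (n + 1) → Δ)) (fun y _ => hf (measurableSet_singleton y))
    simp only [Finset.coe_univ, Set.preimage_univ, measureReal_restrict_apply_univ] at h
    rw [← h]
    refine Finset.sum_congr rfl fun v _ => ?_
    rw [measureReal_restrict_apply (hf (measurableSet_singleton v)), Set.inter_comm]
  rw [key, key {ω | (fun i => Y i ω) ∈ G ∧ Y n ω = a}, Finset.sum_mul]
  refine Finset.sum_congr rfl fun v _ => ?_
  let x : ℕ → Δ := fun i => if h : i < n + 1 then v ⟨i, h⟩ else b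
  have hxv : ∀ ω, f ω = v ↔ ∀ i ≤ n, Y i ω = x i := by
    intro ω
    constructor
    · rintro rfl i hi
      have hi' : i < n + 1 := by omega
      simp only [x, f, hi', dite_true]
    · intro h
      ext i
      have := h i (by omega)
      simpa only [x, f, i.2, dite_true] using this
  have hx1 : x (n + 1) = b := by simp [x]
  by_cases hc : x ∈ G ∧ x n = a
  · have h1 : {ω | (fun i => Y i ω) ∈ G ∧ Y n ω = a ∧ Y (n + 1) ω = b} ∩ f ⁻¹' {v} =
        {ω | ∀ i ≤ n + 1, Y i ω = x i} := by
      ext ω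
      simp only [Set.mem_inter_iff, Set.mem_ofPred_eq, Set.mem_preimage, Set.mem_singleton_iff, hxv]
      constructor
      · rintro ⟨⟨-, -, h⟩, h'⟩ i hi
        rcases Nat.lt_or_ge n i with hn | hn
        · obtain rfl : i = n + 1 := by omega
          rw [h, hx1]
        · exact h' i hn
      · intro h
        refine ⟨⟨hG x _ (fun i hi => (h i (by omega)).symm) hc.1, ?_, ?_⟩,
          fun i hi => h i (by omega)⟩
        · rw [h n (by omega), hc.2]
        · rw [h (n + 1) le_rfl, hx1]
    have h2 : {ω | (fun i => Y i ω) ∈ G ∧ Y n ω = a} ∩ f ⁻¹' {v} =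
        {ω | ∀ i ≤ n, Y i ω = x i} := by
      ext ω
      simp only [Set.mem_inter_iff, Set.mem_ofPred_eq, Set.mem_preimage, Set.mem_singleton_iff, hxv]
      refine ⟨fun h => h.2, fun h => ⟨⟨hG x _ (fun i hi => (h i (by omega)).symm) hc.1, ?_⟩, h⟩⟩
      rw [h n le_rfl, hc.2]
    rw [h1, h2, hY.markov, hx1, hc.2]
  · have h2 : {ω | (fun i => Y i ω) ∈ G ∧ Y n ω = a} ∩ f ⁻¹' {v} = ∅ := by
      ext ω
      simp only [Set.mem_inter_iff, Set.mem_ofPred_eq, Set.mem_preimage, Set.mem_singleton_iff, hxv,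
        Set.mem_empty_iff_false, iff_false, not_and]
      rintro ⟨h, h'⟩ hx
      exact hc ⟨hG _ _ (fun i hi => hx i (by omega)) h, by rw [← hx n le_rfl, h']⟩
    have h1 : {ω | (fun i => Y i ω) ∈ G ∧ Y n ω = a ∧ Y (n + 1) ω = b} ∩ f ⁻¹' {v} = ∅ := by
      rw [← Set.subset_empty_iff, ← h2]
      exact Set.inter_subset_inter_left _ fun ω h => ⟨h.1, h.2.1⟩
    rw [h1, h2]
    simp

lemma IsMarkovChain.follow (hY : IsMarkovChain μ P Y) {n : ℕ} {G : Set (ℕ → Δ)}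
    (hG : Determined (n + 1) G) (z : ℕ → Δ) (r : ℕ) :
    μ.real {ω | (fun i => Y i ω) ∈ G ∧ ∀ j ≤ r, Y (n + j) ω = z j} =
      μ.real {ω | (fun i => Y i ω) ∈ G ∧ Y n ω = z 0} *
        ∏ j ∈ Finset.range r, P (z j) (z (j + 1)) := by
  induction r with
  | zero => simp
  | succ r ih =>
    rw [Finset.prod_range_succ, ← mul_assoc, ← ih]
    have hG' : Determined (n + r + 1) (G ∩ {y | ∀ j ≤ r, y (n + j) = z j}) := by
      refine (hG.mono (by omega)).inter fun y y' hyy h j hj => ?_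
      rw [← hyy _ (by omega)]
      exact h j hj
    have := hY.step hG' (z r) (z (r + 1))
    convert this using 2
    · congr 1
      ext ω
      simp only [Set.mem_ofPred_eq, Set.mem_inter_iff]
      constructor
      · rintro ⟨h1, h2⟩
        exact ⟨⟨h1, fun j hj => h2 j (by omega)⟩, h2 r (by omega), h2 (r + 1) le_rfl⟩
      · rintro ⟨⟨h1, h2⟩, -, h3⟩
        refine ⟨h1, fun j hj => ?_⟩
        rcases Nat.lt_or_ge r j with h | h
        · obtain rfl : j = r + 1 := by omega
          exact h3
        · exact h2 j h
    · congr 1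
      ext ω
      simp only [Set.mem_ofPred_eq, Set.mem_inter_iff]
      exact ⟨fun h => ⟨h, h.2 r le_rfl⟩, fun h => h.1⟩

/-- If from every state some path of positive probability leads out of the decreasing events `F k`,
then the probabilities of these events are summable, with a bound uniform in the events. -/
lemma IsMarkovChain.exists_tsum_le_of_escape (hY : IsMarkovChain μ P Y)
    (r : Δ → ℕ) (z : Δ → ℕ → Δ) (hz : ∀ x, z x 0 = x)
    (hpos : ∀ x, 0 < ∏ j ∈ Finset.range (r x), P (z x j) (z x (j + 1))) :
    ∃ C : ℝ≥0∞, C < ∞ ∧ ∀ (n : ℕ) (F : ℕ → Set (ℕ → Δ)), (∀ k, Determined (n + k + 1) (F k)) →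
      Antitone F →
      (∀ k x y, y ∈ F k → (∀ j ≤ r x, y (n + k + j) = z x j) → y ∉ F (k + r x)) →
      ∑' k, μ {ω | (fun i => Y i ω) ∈ F k} ≤ C * μ {ω | (fun i => Y i ω) ∈ F 0} := by
  obtain ⟨ω0⟩ : Nonempty Ω := nonempty_of_isProbabilityMeasure μ
  have : Nonempty Δ := ⟨Y 0 ω0⟩
  obtain ⟨x0, hx0⟩ := Finite.exists_min
    fun x => ∏ j ∈ Finset.range (r x), P (z x j) (z x (j + 1))
  obtain ⟨x1, hx1⟩ := Finite.exists_max r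
  set ε := ∏ j ∈ Finset.range (r x0), P (z x0 j) (z x0 (j + 1)) with hε
  have hε0 : 0 < ε := hpos x0
  refine ⟨ENNReal.ofReal (r x1 / ε), ENNReal.ofReal_lt_top, fun n F hF hanti hesc => ?_⟩
  set N := r x1
  let Φ : ℕ → Set Ω := fun k => {ω | (fun i => Y i ω) ∈ F k}
  have hΦm : ∀ k, MeasurableSet (Φ k) := fun k => hY.measurable_path (hF k).measurableSet
  have hΦa : Antitone Φ := fun k l hkl ω h => hanti hkl h
  let a : ℕ → ℝ := fun k => μ.real (Φ k)
  have ha0 : ∀ k, 0 ≤ a k := fun k => measureReal_nonneg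
  -- From each current letter `x` the escape path has conditional probability at least `ε`, and it
  -- is out of `F` after `r x ≤ N` steps.
  have hstep : ∀ k, ε * a k ≤ a k - a (k + N) := by
    intro k
    have hsplit : a k = ∑ x, μ.real {ω | (fun i => Y i ω) ∈ F k ∧ Y (n + k) ω = x} := by
      have h := sum_measureReal_preimage_singleton (μ := μ.restrict (Φ k)) (f := Y (n + k))
        (Finset.univ : Finset Δ) (fun y _ => hY.measurable _ (measurableSet_singleton y))
      simp only [Finset.coe_univ, Set.preimage_univ, measureReal_restrict_apply_univ] at h
      rw [show a k = μ.real (Φ k) from rfl, ← h]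
      refine Finset.sum_congr rfl fun v _ => ?_
      rw [measureReal_restrict_apply (hY.measurable _ (measurableSet_singleton v)), Set.inter_comm]
      rfl
    have hdiff : μ.real (Φ k \ Φ (k + N)) = a k - a (k + N) :=
      measureReal_sdiff (hΦa (by omega)) (hΦm _)
    rw [← hdiff]
    calc ε * a k = ∑ x, μ.real {ω | (fun i => Y i ω) ∈ F k ∧ Y (n + k) ω = x} * ε := by
          rw [hsplit, Finset.mul_sum]
          exact Finset.sum_congr rfl fun _ _ => mul_comm _ _
      _ ≤ ∑ x, μ.real {ω | (fun i => Y i ω) ∈ F k ∧ ∀ j ≤ r x, Y (n + k + j) ω = z x j} := by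
          refine Finset.sum_le_sum fun x _ => ?_
          rw [hY.follow (hF k) (z x) (r x), hz]
          exact mul_le_mul_of_nonneg_left (hx0 x) measureReal_nonneg
      _ = μ.real (⋃ x ∈ (Finset.univ : Finset Δ),
            {ω | (fun i => Y i ω) ∈ F k ∧ ∀ j ≤ r x, Y (n + k + j) ω = z x j}) := by
          rw [measureReal_biUnion_finset]
          · intro x _ x' _ hne
            refine Set.disjoint_left.2 fun ω h h' => hne ?_
            rw [← hz x, ← hz x', ← h.2 0 (by omega), ← h'.2 0 (by omega)]
          · intro x _
            refine (hΦm k).inter (measurableSet_setOfPred.2 ?_)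
            refine Measurable.forall fun j => Measurable.imp measurable_const ?_
            exact measurableSet_setOfPred.1 (hY.measurable _ (measurableSet_singleton _))
      _ ≤ μ.real (Φ k \ Φ (k + N)) := by
          refine measureReal_mono ?_
          refine Set.iUnion₂_subset fun x _ ω h => ⟨h.1, fun h' => ?_⟩
          exact hesc k x _ h.1 h.2 (hanti (Nat.add_le_add_left (hx1 x) k) h')
  -- The sum telescopes with gap `N`, so at most `N` terms of size at most `a 0` survive.
  have htel : ∀ m, ∑ k ∈ Finset.range m, (a k - a (k + N)) ≤ N * a 0 := by
    intro m
    have h1 : ∑ k ∈ Finset.range m, (a k - a (k + N)) =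
        ∑ k ∈ Finset.range N, a k - ∑ k ∈ Finset.range N, a (m + k) := by
      have e1 := Finset.sum_range_add a m N
      have e2 := Finset.sum_range_add a N m
      rw [Nat.add_comm N m] at e2
      rw [Finset.sum_sub_distrib]
      have e3 : ∑ k ∈ Finset.range m, a (N + k) = ∑ k ∈ Finset.range m, a (k + N) :=
        Finset.sum_congr rfl fun k _ => by rw [Nat.add_comm]
      linarith
    rw [h1]
    have h2 : ∑ k ∈ Finset.range N, a k ≤ N * a 0 := by
      calc _ ≤ ∑ k ∈ Finset.range N, a 0 :=
            Finset.sum_le_sum fun k _ => measureReal_mono (hΦa (Nat.zero_le k))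
        _ = _ := by simp
    have h3 : 0 ≤ ∑ k ∈ Finset.range N, a (m + k) := Finset.sum_nonneg fun k _ => ha0 _
    linarith
  have hsum : ∀ m, ∑ k ∈ Finset.range m, a k ≤ N / ε * a 0 := by
    intro m
    have h1 : ε * ∑ k ∈ Finset.range m, a k ≤ N * a 0 := by
      rw [Finset.mul_sum]
      exact (Finset.sum_le_sum fun k _ => hstep k).trans (htel m)
    rw [div_mul_eq_mul_div, le_div_iff₀ hε0]
    linarith
  rw [ENNReal.tsum_eq_iSup_nat]
  refine iSup_le fun m => ?_
  have hconv : ∀ k, μ {ω | (fun i => Y i ω) ∈ F k} = ENNReal.ofReal (a k) := fun k => by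
    rw [ofReal_measureReal]
  simp only [hconv]
  rw [← ENNReal.ofReal_sum_of_nonneg fun k _ => ha0 k, ← ENNReal.ofReal_mul (by positivity)]
  exact ENNReal.ofReal_le_ofReal (hsum m)

/-- The Markov property: the law of the text from a letter `x` on is the same, up to a factor, on
all events that are settled when this letter has been read. -/
lemma IsMarkovChain.markov_property (hY : IsMarkovChain μ P Y) {x : Δ} {n₁ n₂ : ℕ}
    {G₁ G₂ : Set (ℕ → Δ)} (hG₁ : Determined (n₁ + 1) G₁) (hG₂ : Determined (n₂ + 1) G₂)
    (hx₁ : ∀ y ∈ G₁, y n₁ = x) (hx₂ : ∀ y ∈ G₂, y n₂ = x)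
    {f : (ℕ → Δ) → ℝ≥0∞} (hf : Measurable f) :
    μ {ω | (fun i => Y i ω) ∈ G₂} *
        ∫⁻ ω in {ω | (fun i => Y i ω) ∈ G₁}, f (fun i => Y (n₁ + i) ω) ∂μ =
      μ {ω | (fun i => Y i ω) ∈ G₁} *
        ∫⁻ ω in {ω | (fun i => Y i ω) ∈ G₂}, f (fun i => Y (n₂ + i) ω) ∂μ := by
  have hm : ∀ n, Measurable fun ω i => Y (n + i) ω :=
    fun n => measurable_pi_lambda _ fun i => hY.measurable _
  -- Two finite measures on paths, compared on cylinders, where `follow` shows that only the common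
  -- letter `x` matters. Cross-multiplication avoids dividing by a probability that may vanish.
  have key : (μ {ω | (fun i => Y i ω) ∈ G₂}) •
        (μ.restrict {ω | (fun i => Y i ω) ∈ G₁}).map (fun ω i => Y (n₁ + i) ω) =
      (μ {ω | (fun i => Y i ω) ∈ G₁}) •
        (μ.restrict {ω | (fun i => Y i ω) ∈ G₂}).map (fun ω i => Y (n₂ + i) ω) := by
    have : IsFiniteMeasure ((μ {ω | (fun i => Y i ω) ∈ G₂}) •
        (μ.restrict {ω | (fun i => Y i ω) ∈ G₁}).map (fun ω i => Y (n₁ + i) ω)) :=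
      ⟨by simpa using ENNReal.mul_lt_top (by simp) (by
        rw [Measure.map_apply (hm _) .univ]; simp)⟩
    refine ext_of_generate_finite _ generateFrom_cylinders isPiSystem_cylinders ?_ ?_
    · rintro _ ⟨z, r, rfl⟩
      have hS : MeasurableSet {y : ℕ → Δ | ∀ j ≤ r, y j = z j} := by
        rw [generateFrom_cylinders]
        exact MeasurableSpace.measurableSet_generateFrom ⟨_, _, rfl⟩
      have hval : ∀ (n : ℕ) (G : Set (ℕ → Δ)), Determined (n + 1) G → (∀ y ∈ G, y n = x) →
          (μ.restrict {ω | (fun i => Y i ω) ∈ G}).map (fun ω i => Y (n + i) ω)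
            {y | ∀ j ≤ r, y j = z j} = μ {ω | (fun i => Y i ω) ∈ G} *
              ENNReal.ofReal (if z 0 = x then ∏ j ∈ Finset.range r, P (z j) (z (j + 1)) else 0) := by
        intro n G hG hx
        rw [Measure.map_apply (hm _) hS, Measure.restrict_apply (hm _ hS), Set.inter_comm]
        have h := hY.follow hG z r
        have e : {ω | (fun i => Y i ω) ∈ G} ∩ (fun ω i => Y (n + i) ω) ⁻¹'
            {y | ∀ j ≤ r, y j = z j} =
            {ω | (fun i => Y i ω) ∈ G ∧ ∀ j ≤ r, Y (n + j) ω = z j} := rfl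
        rw [e, ← ofReal_measureReal, h, ENNReal.ofReal_mul measureReal_nonneg, ofReal_measureReal]
        split_ifs with hzx
        · congr 2
          ext ω
          simp only [Set.mem_ofPred_eq, and_iff_left_iff_imp]
          intro h
          rw [hzx]
          exact hx _ h
        · have : {ω | (fun i => Y i ω) ∈ G ∧ Y n ω = z 0} = ∅ := by
            ext ω
            simp only [Set.mem_ofPred_eq, Set.mem_empty_iff_false, iff_false, not_and]
            intro h h'
            exact hzx (h'.symm.trans (hx _ h))
          simp [this]
      simp only [Measure.smul_apply, smul_eq_mul]
      rw [hval _ _ hG₁ hx₁, hval _ _ hG₂ hx₂]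
      ring
    · simp only [Measure.smul_apply, smul_eq_mul]
      rw [Measure.map_apply (hm _) .univ, Measure.map_apply (hm _) .univ]
      simp [mul_comm]
  have h := congrArg (fun ν => ∫⁻ y, f y ∂ν) key
  simp only [lintegral_smul_measure, smul_eq_mul] at h
  rwa [lintegral_map hf (hm _), lintegral_map hf (hm _)] at h

end Markov

/-! ### First times with values in `ℕ∞` -/

section FirstTime

variable {p : ℕ → Prop}

lemma sInf_eq_coe {n : ℕ} :
    sInf {t : ℕ∞ | ∃ n : ℕ, t = n ∧ p n} = n ↔ p n ∧ ∀ m < n, ¬ p m := by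
  constructor
  · intro h
    have hne : {t : ℕ∞ | ∃ n : ℕ, t = n ∧ p n}.Nonempty := by
      by_contra hc
      rw [Set.not_nonempty_iff_eq_empty] at hc
      rw [hc, sInf_empty] at h
      exact ENat.natCast_ne_top n h.symm
    obtain ⟨m, hm, hp⟩ := csInf_mem hne
    obtain rfl : n = m := by exact_mod_cast h.symm.trans hm
    refine ⟨hp, fun k hk hpk => ?_⟩
    have : sInf {t : ℕ∞ | ∃ n : ℕ, t = n ∧ p n} ≤ k := sInf_le ⟨k, rfl, hpk⟩
    rw [h] at this
    exact absurd (by exact_mod_cast this : n ≤ k) (by omega)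
  · rintro ⟨hp, hmin⟩
    apply le_antisymm
    · exact sInf_le ⟨n, rfl, hp⟩
    · refine le_sInf ?_
      rintro _ ⟨m, rfl, hm⟩
      by_contra hc
      exact hmin m (by exact_mod_cast not_le.1 hc) hm

lemma lt_sInf_iff {k : ℕ} :
    (k : ℕ∞) < sInf {t : ℕ∞ | ∃ n : ℕ, t = n ∧ p n} ↔ ∀ m ≤ k, ¬ p m := by
  constructor
  · intro h m hm hp
    have : sInf {t : ℕ∞ | ∃ n : ℕ, t = n ∧ p n} ≤ m := sInf_le ⟨m, rfl, hp⟩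
    exact absurd (h.trans_le this) (by exact_mod_cast not_lt.2 hm)
  · intro h
    refine lt_of_lt_of_le (b := ((k + 1 : ℕ) : ℕ∞)) (by exact_mod_cast Nat.lt_succ_self k) ?_
    refine le_sInf ?_
    rintro _ ⟨m, rfl, hm⟩
    by_contra hc
    have : m < k + 1 := by exact_mod_cast not_le.1 hc
    exact h m (by omega) hm

lemma eq_of_forall_eq_coe_iff {a b : ℕ∞} (h : ∀ n : ℕ, a = n ↔ b = n) : a = b := by
  induction a using ENat.recTopCoe with
  | top =>
    symm
    rw [ENat.eq_top_iff_forall_ne]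
    intro m hm
    exact ENat.natCast_ne_top m ((h m).2 hm.symm).symm
  | coe a => exact ((h a).1 rfl).symm

end FirstTime

/-! ### Walks between two barriers -/

section Bounded

/-- Steps of size at most one cannot jump over a barrier. -/
lemma walk_mem_Ioo {W : ℕ → ℤ} {A B : ℤ} (hA : 0 < A) (hB : 0 < B) (h0 : W 0 = 0)
    (hstep : ∀ j, W (j + 1) ≤ W j + 1 ∧ W j - 1 ≤ W (j + 1)) {k : ℕ}
    (hk : ∀ j, 1 ≤ j → j ≤ k → ¬ (W j = A ∨ W j = -B)) :
    ∀ j ≤ k, -B < W j ∧ W j < A := by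
  intro j
  induction j with
  | zero => intro _; omega
  | succ j ih =>
    intro hj
    have := ih (by omega)
    have := hk (j + 1) (by omega) hj
    have := hstep j
    omega

end Bounded

/-! ### Occurrences of words and their times -/

section Words

variable {Δ : Type*} {U D : List Δ} {w v : List Δ} {y y' : ℕ → Δ} {n m k : ℕ}

lemma OccursAt.congr (h : ∀ i < n, y i = y' i) (hw : OccursAt w y n) : OccursAt w y' n := by
  refine ⟨hw.1, fun j => ?_⟩
  rw [← h _ (by have := j.2; have := hw.1; omega)]
  exact hw.2 j

/-- The block of letters read by `w` lies inside the block read by `v`, at offset `d`. -/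
lemma OccursAt.infix (hw : OccursAt w y n) (hv : OccursAt v y m)
    (h1 : m - v.length ≤ n - w.length) (h2 : n ≤ m) : w <:+: v := by
  have hw1 := hw.1
  have hv1 := hv.1
  set d := (n - w.length) - (m - v.length) with hd
  have : w = (v.drop d).take w.length := by
    apply List.ext_get
    · simp only [List.length_take, List.length_drop]
      omega
    · intro i h h'
      have e1 := hw.2 ⟨i, h⟩
      have e2 := hv.2 ⟨d + i, by omega⟩
      simp only [List.get_eq_getElem] at e1 e2 ⊢
      rw [List.getElem_take, List.getElem_drop, ← e1, ← e2]
      congr 1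
      omega
  rw [this]
  exact (List.take_prefix _ _).isInfix.trans (List.drop_suffix _ _).isInfix

/-- The word that a sign stands for. -/
def word (U D : List Δ) (s : ℤˣ) : List Δ := if s = 1 then U else D

/-- Neither of the two words is a contiguous subword of the other. -/
def Unnested (U D : List Δ) : Prop := ∀ s s' : ℤˣ, word U D s <:+: word U D s' → s = s'

lemma unnested_of_not_infix (hUD : ¬ U <:+: D) (hDU : ¬ D <:+: U) : Unnested U D := by
  intro s s' h
  rcases Int.units_eq_one_or s with rfl | rfl <;> rcases Int.units_eq_one_or s' with rfl | rfl <;>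
    simp_all [word]

lemma Unnested.length_pos (h : Unnested U D) (s : ℤˣ) : 0 < (word U D s).length := by
  rw [List.length_pos_iff]
  intro h0
  have := h s (-s) (by rw [h0]; exact List.nil_infix)
  rcases Int.units_eq_one_or s with rfl | rfl <;> revert this <;> decide

lemma occurs_iff : (OccursAt U y n ∨ OccursAt D y n) ↔ ∃ s : ℤˣ, OccursAt (word U D s) y n := by
  constructor
  · rintro (h | h)
    · exact ⟨1, by simpa [word] using h⟩
    · exact ⟨-1, by simpa [word] using h⟩
  · rintro ⟨s, h⟩
    rcases Int.units_eq_one_or s with rfl | rfl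
    · exact Or.inl (by simpa [word] using h)
    · exact Or.inr (by simpa [word] using h)

/-- Of two words that end at the same time, the shorter is a suffix of the longer. -/
lemma Unnested.sign_unique (h : Unnested U D) {s s' : ℤˣ} (hs : OccursAt (word U D s) y n)
    (hs' : OccursAt (word U D s') y n) : s = s' := by
  have := hs.1
  have := hs'.1
  rcases le_total (word U D s).length (word U D s').length with hl | hl
  · exact h _ _ (hs.infix hs' (by omega) le_rfl)
  · exact (h _ _ (hs'.infix hs (by omega) le_rfl)).symm

lemma wordTime_succ_eq_iff : wordTime U D y (k + 1) = n ↔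
    (wordTime U D y k < n ∧ ∃ s, OccursAt (word U D s) y n) ∧
      ∀ m : ℕ, m < n → wordTime U D y k < m → ∀ s, ¬ OccursAt (word U D s) y m := by
  rw [wordTime, sInf_eq_coe, occurs_iff]
  refine and_congr_right fun _ => forall₂_congr fun m _ => ?_
  rw [occurs_iff]
  push Not
  rfl

/-- This is the stopping time property of `τₖ`. -/
lemma wordTime_congr (h : ∀ i < n, y i = y' i) (hk : wordTime U D y k = n) :
    wordTime U D y' k = n := by
  induction k generalizing n with
  | zero => exact hk
  | succ k ih =>
    rw [wordTime_succ_eq_iff] at hk ⊢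
    obtain ⟨⟨h1, s, h2⟩, h3⟩ := hk
    obtain ⟨m, hm⟩ := ENat.ne_top_iff_exists.1 (ne_top_of_lt h1)
    rw [← hm] at h1 h3
    have hmn : m < n := by exact_mod_cast h1
    have := ih (fun i hi => h i (by omega)) hm.symm
    rw [this]
    refine ⟨⟨h1, s, h2.congr h⟩, fun l hl hml s hs => h3 l hl hml s ?_⟩
    exact hs.congr fun i hi => (h i (by omega)).symm

lemma Unnested.wordSign_eq_iff (h : Unnested U D) {s : ℤˣ} :
    wordSign U D y k = s ↔ ∃ n : ℕ, wordTime U D y k = n ∧ OccursAt (word U D s) y n := by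
  have e1 : word U D 1 = U := by simp [word]
  have e2 : word U D (-1) = D := by simp [word]
  have hex : (∃ n : ℕ, wordTime U D y k = n ∧ OccursAt U y n) →
      ¬ ∃ n : ℕ, wordTime U D y k = n ∧ OccursAt D y n := by
    rintro ⟨n, hn, hU⟩ ⟨m, hm, hD⟩
    obtain rfl : n = m := by exact_mod_cast hn.symm.trans hm
    have := h.sign_unique (s := 1) (s' := -1) (by rwa [e1]) (by rwa [e2])
    revert this; decide
  unfold wordSign
  rcases Int.units_eq_one_or s with rfl | rfl
  · rw [e1]
    split_ifs with h1 h2 <;> simp [h1]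
  · rw [e2]
    split_ifs with h1 h2
    · simp [hex h1]
    · simp [h2]
    · simp [h2]

lemma Unnested.exists_wordSign (h : Unnested U D) (hk : wordTime U D y (k + 1) = n) :
    ∃ s : ℤˣ, wordSign U D y (k + 1) = s ∧ OccursAt (word U D s) y n := by
  obtain ⟨⟨-, s, hs⟩, -⟩ := wordTime_succ_eq_iff.1 hk
  exact ⟨s, h.wordSign_eq_iff.2 ⟨n, hk, hs⟩, hs⟩

lemma wordSign_of_top (hk : wordTime U D y k = ⊤) :
    wordSign U D y k = 0 := by
  unfold wordSign
  simp [hk]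

lemma wordTime_lt_succ {n : ℕ} (hk : wordTime U D y k = n) :
    wordTime U D y k < wordTime U D y (k + 1) := by
  rw [hk, wordTime, lt_sInf_iff]
  rintro m hm ⟨h, -⟩
  rw [hk] at h
  exact absurd (by exact_mod_cast h : n < m) (by omega)

lemma wordTime_mono_of_eq {j : ℕ} (hk : wordTime U D y k = n) (hj : j ≤ k) :
    ∃ m ≤ n, wordTime U D y j = m := by
  induction k generalizing n with
  | zero =>
    obtain rfl : j = 0 := by omega
    exact ⟨n, le_rfl, hk⟩
  | succ k ih =>
    rcases Nat.lt_or_ge k j with h | h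
    · obtain rfl : j = k + 1 := by omega
      exact ⟨n, le_rfl, hk⟩
    · have h1 := (wordTime_succ_eq_iff.1 hk).1.1
      obtain ⟨m, hm⟩ := ENat.ne_top_iff_exists.1 (ne_top_of_lt h1)
      rw [← hm] at h1
      have hmn : m < n := by exact_mod_cast h1
      obtain ⟨l, hl, hl'⟩ := ih hm.symm h
      exact ⟨l, by omega, hl'⟩

lemma wordSign_congr {j : ℕ} (hyy : ∀ i < n, y i = y' i)
    (hk : wordTime U D y k = n) (hj : j ≤ k) :
    wordSign U D y' j = wordSign U D y j := by
  obtain ⟨m, hm, hjm⟩ := wordTime_mono_of_eq hk hj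
  have hyy' : ∀ i < m, y i = y' i := fun i hi => hyy i (by omega)
  have hjm' := wordTime_congr hyy' hjm
  have e : ∀ w, (∃ l : ℕ, wordTime U D y' j = l ∧ OccursAt w y' l) ↔
      (∃ l : ℕ, wordTime U D y j = l ∧ OccursAt w y l) := by
    intro w
    rw [hjm, hjm']
    constructor <;> rintro ⟨l, hl, ho⟩ <;> obtain rfl : m = l := by exact_mod_cast hl
    · exact ⟨m, rfl, ho.congr fun i hi => (hyy' i hi).symm⟩
    · exact ⟨m, rfl, ho.congr hyy'⟩
  unfold wordSign
  rw [propext (e U), propext (e D)]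

/-- The truncated subtraction is harmless, because `τₖ` is finite and smaller than `τₖ₊₁`. -/
lemma waitTime_succ_eq_iff (hk : wordTime U D y k = n) :
    waitTime U D y (k + 1) = m ↔ wordTime U D y (k + 1) = (n + m : ℕ) := by
  have hlt := wordTime_lt_succ hk
  unfold waitTime
  rw [Nat.add_sub_cancel]
  rw [hk] at hlt ⊢
  generalize wordTime U D y (k + 1) = T at hlt ⊢
  induction T using ENat.recTopCoe with
  | top =>
    rw [ENat.top_sub_natCast]
    exact ⟨fun h => absurd h.symm (ENat.natCast_ne_top _),
      fun h => absurd h.symm (ENat.natCast_ne_top _)⟩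
  | coe l =>
    have : n < l := by exact_mod_cast hlt
    norm_cast
    omega

/-- The word `w` without its last letter, followed by the text `z`. -/
def glue (w : List Δ) (z : ℕ → Δ) : ℕ → Δ :=
  fun i => if h : i + 1 < w.length then w.get ⟨i, by omega⟩ else z (i - (w.length - 1))

/-- The text from the first letter of `w` is a function of the text from its last letter, which is
the part that the Markov property controls. -/
lemma OccursAt.glue_eq (hw : OccursAt w y n) (hpos : 0 < w.length) :
    glue w (fun i => y (n - 1 + i)) = fun i => y (n - w.length + i) := by
  ext i
  have := hw.1
  unfold glue
  split_ifs with h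
  · exact (hw.2 ⟨i, by omega⟩).symm
  · exact congrArg y (by omega)

/-- A `v` completed at or after time `n` that started before `w` would contain `w`. This is
impossible for `v = w` by length, and otherwise by `hv`. -/
lemma OccursAt.shift_iff (hw : OccursAt w y n) (hv : v = w ∨ ¬ w <:+: v) {s : ℕ} :
    OccursAt v (fun i => y (n - w.length + i)) (w.length + s) ↔ OccursAt v y (n + s) := by
  have hw1 := hw.1
  constructor
  · rintro ⟨h1, h2⟩
    refine ⟨by omega, fun j => ?_⟩
    rw [← h2 j]
    exact congrArg y (by omega)
  · intro h
    have h1 : v.length ≤ w.length + s := by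
      by_contra hc
      rcases hv with rfl | hv
      · omega
      · exact hv (hw.infix h (by omega) (by omega))
    refine ⟨h1, fun j => ?_⟩
    rw [← h.2 j]
    exact congrArg y (by omega)

/-- If the text starts with one of the words, then this word is the first to occur. -/
lemma Unnested.wordTime_one (h : Unnested U D) {s : ℤˣ}
    (hs : OccursAt (word U D s) y (word U D s).length) :
    wordTime U D y 1 = (word U D s).length := by
  rw [wordTime_succ_eq_iff]
  refine ⟨⟨?_, s, hs⟩, ?_⟩
  · rw [wordTime]; exact_mod_cast h.length_pos s
  · intro m hm _ s' hs'
    have he : (word U D s').length = (word U D s).length := by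
      rw [h _ _ (hs'.infix hs (by omega) hm.le)]
    have := hs'.1
    omega

/-- After an occurrence of a word the text is read as if it had started with this word. -/
lemma Unnested.shift (h : Unnested U D) {s : ℤˣ} (hk : wordTime U D y k = n)
    (hs : OccursAt (word U D s) y n) :
    waitTime U D (fun i => y (n - (word U D s).length + i)) 2 = waitTime U D y (k + 1) ∧
    wordSign U D (fun i => y (n - (word U D s).length + i)) 2 = wordSign U D y (k + 1) := by
  set w := word U D s with hw
  set y' : ℕ → Δ := fun i => y (n - w.length + i) with hy'
  have hocc : ∀ (s' : ℤˣ) (r : ℕ),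
      OccursAt (word U D s') y' (w.length + r) ↔ OccursAt (word U D s') y (n + r) := by
    intro s' r
    refine hs.shift_iff ?_
    by_cases he : s = s'
    · exact Or.inl (by rw [← he])
    · exact Or.inr fun hc => he (h _ _ hc)
  have hw0 : 0 < w.length := h.length_pos s
  have ht1 : wordTime U D y' 1 = w.length := h.wordTime_one ((hocc s 0).2 hs)
  -- The clocks of the two texts differ by `n - w.length`, and the `k`-th occurrence in `y` is the
  -- first one in `y'`.
  have hnext : ∀ r : ℕ, wordTime U D y' 2 = (w.length + r : ℕ) ↔
      wordTime U D y (k + 1) = (n + r : ℕ) := by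
    intro r
    rw [wordTime_succ_eq_iff, wordTime_succ_eq_iff, ht1, hk]
    simp only [Nat.cast_lt, hocc]
    have e1 : w.length < w.length + r ↔ n < n + r := by omega
    rw [e1]
    refine and_congr_right fun _ => ?_
    constructor
    · intro hh m hm hnm s' hs'
      obtain ⟨q, rfl⟩ := Nat.exists_eq_add_of_lt hnm
      exact hh (w.length + q + 1) (by omega) (by omega) s' ((hocc s' (q + 1)).2 hs')
    · intro hh m hm hnm s' hs'
      obtain ⟨q, rfl⟩ := Nat.exists_eq_add_of_lt hnm
      exact hh (n + q + 1) (by omega) (by omega) s' ((hocc s' (q + 1)).1 hs')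
  constructor
  · refine eq_of_forall_eq_coe_iff fun r => ?_
    rw [waitTime_succ_eq_iff hk, waitTime_succ_eq_iff ht1, hnext]
  · have hlt := wordTime_lt_succ hk
    rw [hk] at hlt
    -- If no further word occurs, both signs take the default value `0`.
    by_cases htop : wordTime U D y (k + 1) = ⊤
    · rw [wordSign_of_top htop, wordSign_of_top]
      rw [ENat.eq_top_iff_forall_ne]
      intro m hm
      have hlt' := wordTime_lt_succ ht1
      rw [ht1] at hlt'
      change _ < wordTime U D y' 2 at hlt'
      rw [← hm] at hlt'
      have : w.length < m := by exact_mod_cast hlt'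
      obtain ⟨q, rfl⟩ := Nat.exists_eq_add_of_lt this
      have := (hnext (q + 1)).1 hm.symm
      rw [htop] at this
      exact ENat.natCast_ne_top _ this.symm
    · obtain ⟨m, hm⟩ := ENat.ne_top_iff_exists.1 htop
      rw [← hm] at hlt
      have : n < m := by exact_mod_cast hlt
      obtain ⟨q, rfl⟩ := Nat.exists_eq_add_of_lt this
      have h2 := (hnext (q + 1)).2 hm.symm
      obtain ⟨s', e, ho⟩ := h.exists_wordSign hm.symm
      rw [e, h.wordSign_eq_iff]
      exact ⟨_, h2, (hocc s' (q + 1)).2 ho⟩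

/-! ### The game and the embedded walk -/

lemma score_succ_of_occurs (h : Unnested U D) {s : ℤˣ} (hs : OccursAt (word U D s) y (n + 1)) :
    score U D y (n + 1) = score U D y n + s := by
  unfold score
  rw [Finset.sum_Icc_succ_top (by omega)]
  congr 1
  have e1 : word U D 1 = U := by simp [word]
  have e2 : word U D (-1) = D := by simp [word]
  have hne : ¬ OccursAt (word U D (-s)) y (n + 1) := by
    intro hc
    have := h.sign_unique hs hc
    rcases Int.units_eq_one_or s with rfl | rfl <;> revert this <;> decide
  rcases Int.units_eq_one_or s with rfl | rfl
  · rw [e1] at hs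
    rw [e2] at hne
    simp [hs, hne]
  · rw [e2] at hs
    rw [neg_neg, e1] at hne
    simp [hs, hne]

lemma score_succ_of_not_occurs (hs : ∀ s, ¬ OccursAt (word U D s) y (n + 1)) :
    score U D y (n + 1) = score U D y n := by
  unfold score
  rw [Finset.sum_Icc_succ_top (by omega)]
  have := mt occurs_iff.1 (not_exists.2 hs)
  push Not at this
  simp [this.1, this.2]

lemma score_eq_of_not_occurs (hmn : m ≤ n)
    (hs : ∀ l, m < l → l ≤ n → ∀ s, ¬ OccursAt (word U D s) y l) :
    score U D y n = score U D y m := by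
  induction n, hmn using Nat.le_induction with
  | base => rfl
  | succ n hmn ih =>
    rw [score_succ_of_not_occurs fun s => hs (n + 1) (by omega) le_rfl s]
    exact ih fun l h1 h2 => hs l h1 (by omega)

/-- The partial sums `X₁ + ⋯ + Xₖ`. -/
def walk (U D : List Δ) (y : ℕ → Δ) (k : ℕ) : ℤ := ∑ j ∈ Finset.Icc 1 k, wordSign U D y j

lemma walk_succ : walk U D y (k + 1) = walk U D y k + wordSign U D y (k + 1) := by
  unfold walk
  rw [Finset.sum_Icc_succ_top (by omega)]

lemma ruinTime_eq_iff {A B : ℤ} : ruinTime U D A B y = k ↔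
    (1 ≤ k ∧ (walk U D y k = A ∨ walk U D y k = -B)) ∧
      ∀ j < k, ¬ (1 ≤ j ∧ (walk U D y j = A ∨ walk U D y j = -B)) :=
  sInf_eq_coe

lemma lt_ruinTime_iff {A B : ℤ} : (k : ℕ∞) < ruinTime U D A B y ↔
    ∀ j ≤ k, ¬ (1 ≤ j ∧ (walk U D y j = A ∨ walk U D y j = -B)) :=
  lt_sInf_iff

variable {t : ℕ → ℕ}

lemma strictMono_of_wordTime (ht : ∀ k, wordTime U D y k = t k) : StrictMono t :=
  strictMono_nat_of_lt_succ fun k => by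
    have := wordTime_lt_succ (ht k)
    rw [ht, ht] at this
    exact_mod_cast this

lemma score_eq_score_wordTime (ht : ∀ k, wordTime U D y k = t k) (h1 : t k ≤ n)
    (h2 : n < t (k + 1)) : score U D y n = score U D y (t k) := by
  refine score_eq_of_not_occurs h1 fun l hl hl' => ?_
  have := (wordTime_succ_eq_iff.1 (ht (k + 1))).2 l (by omega)
  rw [ht k] at this
  exact this (by exact_mod_cast hl)

lemma Unnested.score_wordTime (h : Unnested U D) (ht : ∀ k, wordTime U D y k = t k) :
    ∀ k, score U D y (t k) = walk U D y k := by
  intro k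
  induction k with
  | zero =>
    have : t 0 = 0 := by have := ht 0; rw [wordTime] at this; exact_mod_cast this.symm
    simp [this, score, walk]
  | succ k ih =>
    obtain ⟨s, hs, ho⟩ := h.exists_wordSign (ht (k + 1))
    have hlt : t k < t (k + 1) := strictMono_of_wordTime ht (Nat.lt_succ_self k)
    obtain ⟨q, hq⟩ := Nat.exists_eq_add_of_lt hlt
    rw [walk_succ, hs, ← ih, hq, score_succ_of_occurs h (by rwa [hq] at ho),
      score_eq_score_wordTime ht (k := k) (n := t k + q) (by omega) (by omega)]

/-- The score is constant between word times and equals the walk at them, so it reaches a barrier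
exactly when the walk does. -/
lemma Unnested.gameTime_eq (h : Unnested U D) (ht : ∀ k, wordTime U D y k = t k) {A B : ℤ}
    (hA : 0 < A) (hB : 0 < B) (hk : ruinTime U D A B y = k) :
    gameTime U D A B y = t k := by
  rw [ruinTime_eq_iff] at hk
  obtain ⟨⟨hk1, hk2⟩, hk3⟩ := hk
  have hmono := strictMono_of_wordTime ht
  have h0 : t 0 = 0 := by have := ht 0; rw [wordTime] at this; exact_mod_cast this.symm
  refine sInf_eq_coe.2 ⟨⟨?_, ?_⟩, ?_⟩
  · have := hmono (show 0 < k by omega)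
    omega
  · rwa [h.score_wordTime ht]
  · rintro n hn ⟨hn1, hn2⟩
    -- The least such `j` is the index of the last word time up to `n`.
    have hex : ∃ j, n < t (j + 1) := ⟨n, by
      have := hmono.id_le (n + 1)
      simp only [id] at this
      omega⟩
    classical
    have hj := Nat.find_spec hex
    have hj' : t (Nat.find hex) ≤ n := by
      rcases Nat.eq_zero_or_pos (Nat.find hex) with hz | hz
      · rw [hz, h0]; omega
      · have := Nat.find_min hex (m := Nat.find hex - 1) (by omega)
        rw [Nat.sub_add_cancel hz] at this
        omega
    set j := Nat.find hex
    rw [score_eq_score_wordTime ht hj' hj, h.score_wordTime ht] at hn2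
    have hjk : j < k := by
      have := hj'.trans_lt hn
      exact hmono.lt_iff_lt.1 this
    -- Before the first word the score is `0`, which is no barrier since `A` and `B` are positive.
    rcases Nat.eq_zero_or_pos j with hz | hz
    · rw [hz] at hn2
      simp [walk] at hn2
      omega
    · exact hk3 j hjk ⟨hz, hn2⟩

end Words

/-! ### Random times and the tail-sum formula -/

section Measurability

variable {α : Type*} [MeasurableSpace α]

lemma measurable_enat_of_coe {f : α → ℕ∞} (h : ∀ n : ℕ, MeasurableSet {x | f x = n}) :
    Measurable f := by
  refine measurable_to_countable' fun a => ?_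
  induction a using ENat.recTopCoe with
  | top =>
    have : f ⁻¹' {⊤} = (⋃ n : ℕ, {x | f x = n})ᶜ := by
      ext x
      simp only [Set.mem_preimage, Set.mem_singleton_iff, Set.mem_compl_iff, Set.mem_iUnion,
        Set.mem_ofPred_eq, not_exists]
      rw [ENat.eq_top_iff_forall_ne]
      exact forall_congr' fun n => ne_comm
    rw [this]
    exact (MeasurableSet.iUnion h).compl
  | coe n => exact h n

/-- Integrated, this expresses an expected time as the sum of its tail probabilities. -/
lemma enat_toENNReal_eq_tsum (t : ℕ∞) :
    (t : ℝ≥0∞) = ∑' r : ℕ, if (r : ℕ∞) < t then 1 else 0 := by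
  induction t using ENat.recTopCoe with
  | top => simp [ENat.natCast_lt_top]
  | coe n =>
    rw [tsum_eq_sum (s := Finset.range n)]
    · rw [Finset.sum_congr rfl (g := fun _ => 1)]
      · simp
      · intro r hr
        simp [Finset.mem_range.1 hr]
    · intro r hr
      have : ¬ r < n := by simpa using hr
      simp [this]

end Measurability

/-! ### Measurability of word times, signs and the ruin time -/

section Words

variable {Δ : Type*} {U D : List Δ} {w : List Δ} {n k : ℕ}

lemma determined_wordTime : Determined n {y | wordTime U D y k = n} :=
  fun _ _ hyy h => wordTime_congr hyy h

lemma determined_occursAt : Determined n {y | OccursAt w y n} :=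
  fun _ _ hyy h => OccursAt.congr hyy h

lemma measurable_glue [MeasurableSpace Δ] (w : List Δ) : Measurable (glue w) := by
  refine measurable_pi_lambda _ fun i => ?_
  unfold glue
  split_ifs
  · exact measurable_const
  · exact measurable_pi_apply _

/-- A text that begins with one of the words has that word as its first occurrence. -/
lemma Unnested.firstSign_pos {Ω : Type*} [MeasurableSpace Ω] {μ : Measure Ω}
    {Y : ℕ → Ω → Δ} (h : Unnested U D) (s : ℤˣ)
    (hs : 0 < μ {ω | ∀ j : Fin (word U D s).length, Y j ω = (word U D s).get j}) :
    0 < μ (firstSign Y U D s) := by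
  refine hs.trans_le (measure_mono fun ω hω => ?_)
  have ho : OccursAt (word U D s) (fun i => Y i ω) (word U D s).length :=
    ⟨le_rfl, fun j => by simpa using hω j⟩
  exact h.wordSign_eq_iff.2 ⟨_, h.wordTime_one ho, ho⟩

variable [Finite Δ] [MeasurableSpace Δ] [DiscreteMeasurableSpace Δ]

lemma measurable_wordTime : Measurable fun y : ℕ → Δ => wordTime U D y k :=
  measurable_enat_of_coe fun _ => determined_wordTime.measurableSet

lemma measurable_waitTime : Measurable fun y : ℕ → Δ => waitTime U D y k :=
  (Measurable.of_discrete (f := fun p : ℕ∞ × ℕ∞ => p.1 - p.2)).comp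
    (measurable_wordTime.prodMk measurable_wordTime)

lemma measurable_wordSign : Measurable fun y : ℕ → Δ => wordSign U D y k := by
  have h : ∀ w : List Δ, MeasurableSet
      {y : ℕ → Δ | ∃ n : ℕ, wordTime U D y k = n ∧ OccursAt w y n} := by
    intro w
    have : {y : ℕ → Δ | ∃ n : ℕ, wordTime U D y k = n ∧ OccursAt w y n} =
        ⋃ n : ℕ, {y | wordTime U D y k = n} ∩ {y | OccursAt w y n} := by
      ext y
      simp
    rw [this]
    exact MeasurableSet.iUnion fun n => (determined_wordTime.inter determined_occursAt).measurableSet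
  exact Measurable.ite (h U) measurable_const (Measurable.ite (h D) measurable_const measurable_const)

lemma measurable_walk : Measurable fun y : ℕ → Δ => walk U D y k :=
  Finset.measurable_sum _ fun _ _ => measurable_wordSign

lemma measurable_ruinTime {A B : ℤ} : Measurable fun y : ℕ → Δ => ruinTime U D A B y := by
  refine measurable_enat_of_coe fun n => ?_
  have hs : ∀ (j : ℕ) (a : ℤ), MeasurableSet {y : ℕ → Δ | walk U D y j = a} :=
    fun j a => measurable_walk (measurableSet_singleton a)
  simp only [ruinTime_eq_iff]
  have h1 : ∀ j : ℕ, MeasurableSet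
      {y : ℕ → Δ | 1 ≤ j ∧ (walk U D y j = A ∨ walk U D y j = -B)} :=
    fun j => (MeasurableSet.const _).inter ((hs j A).union (hs j (-B)))
  refine (h1 n).inter (measurableSet_setOfPred.2 ?_)
  exact Measurable.forall fun j => Measurable.imp measurable_const
    (measurableSet_setOfPred.1 (h1 j).compl)

end Words

/-! ### Paths of positive probability -/

section Paths

variable {Δ : Type*} [Fintype Δ] [DecidableEq Δ] {P : Matrix Δ Δ ℝ}

/-- A positive entry of a matrix power has a positive summand, which supplies the last but one state
of the path. -/
lemma exists_path_of_pow_pos (hP : ∀ i j, 0 ≤ P i j) (m : ℕ) (x u : Δ) (h : 0 < (P ^ m) x u) :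
    ∃ c : ℕ → Δ, c 0 = x ∧ c m = u ∧ 0 < ∏ j ∈ Finset.range m, P (c j) (c (j + 1)) := by
  induction m generalizing u with
  | zero =>
    refine ⟨fun _ => x, rfl, ?_, by simp⟩
    by_contra hne
    simp [Matrix.one_apply_ne hne] at h
  | succ m ih =>
    rw [pow_succ, Matrix.mul_apply] at h
    obtain ⟨v, -, hv⟩ := Finset.exists_lt_of_sum_lt (s := Finset.univ)
      (f := fun _ => (0 : ℝ)) (by simpa using h)
    have hPv : 0 < P v u := (hP v u).lt_of_ne fun h0 => by simp [← h0] at hv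
    have hPm : 0 < (P ^ m) x v := pos_of_mul_pos_left hv hPv.le
    obtain ⟨c, h0, hm, hpos⟩ := ih v hPm
    refine ⟨fun j => if j ≤ m then c j else u, by simpa using h0, by simp, ?_⟩
    rw [Finset.prod_range_succ]
    have e : ∏ j ∈ Finset.range m, P (if j ≤ m then c j else u) (if j + 1 ≤ m then c (j + 1) else u)
        = ∏ j ∈ Finset.range m, P (c j) (c (j + 1)) := by
      refine Finset.prod_congr rfl fun j hj => ?_
      have := Finset.mem_range.1 hj
      rw [if_pos (by omega), if_pos (by omega)]
    rw [e]
    refine mul_pos hpos ?_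
    simpa [hm] using hPv

end Paths

/-! ### Expected waits and renewal at word times -/

section Renewal

variable {Ω Δ : Type*} [MeasurableSpace Ω] {μ : Measure Ω} [IsProbabilityMeasure μ]
  [Fintype Δ] [DecidableEq Δ] [MeasurableSpace Δ] [DiscreteMeasurableSpace Δ]
  {P : Matrix Δ Δ ℝ} {Y : ℕ → Ω → Δ} {U D : List Δ}

/-- From every letter some text of positive probability leads to the completion of `w`. -/
lemma IsMarkovChain.exists_path_to_word (hY : IsMarkovChain μ P Y) (hP : P.IsIrreducible)
    {w : List Δ} (hw0 : 0 < w.length) (hw : 0 < μ {ω | ∀ j : Fin w.length, Y j ω = w.get j})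
    (x : Δ) : ∃ (r : ℕ) (z : ℕ → Δ), z 0 = x ∧ w.length ≤ r + 1 ∧
      (∀ j : Fin w.length, z (r + 1 - w.length + j) = w.get j) ∧
      0 < ∏ j ∈ Finset.range r, P (z j) (z (j + 1)) := by
  let v : ℕ → Δ := fun j => if h : j < w.length then w.get ⟨j, h⟩ else x
  -- The text starts with `w` with positive probability, and this product is a factor of that
  -- probability.
  have hv : 0 < ∏ j ∈ Finset.range (w.length - 1), P (v j) (v (j + 1)) := by
    refine (Finset.prod_nonneg fun j _ => hY.nonneg _ _).lt_of_ne fun h0 => ?_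
    have hf := hY.follow (n := 0) (G := Set.univ) (fun _ _ _ _ => trivial) v (w.length - 1)
    rw [← h0, mul_zero, measureReal_eq_zero_iff] at hf
    refine hw.ne' (measure_mono_null (fun ω hω => ?_) hf)
    refine ⟨trivial, fun j hj => ?_⟩
    have hj' : j < w.length := by omega
    have := hω ⟨j, hj'⟩
    simp only [Nat.zero_add, v, hj', dite_true]
    exact this
  obtain ⟨m, -, hm⟩ := (Matrix.isIrreducible_iff_exists_pow_pos hY.nonneg).1 hP x (v 0)
  obtain ⟨c, hc0, hcm, hc⟩ := exists_path_of_pow_pos hY.nonneg m x (v 0) hm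
  -- The path runs from `x` to the first letter of `w` in `m` steps, by irreducibility, and then
  -- spells `w`.
  let z : ℕ → Δ := fun j => if j ≤ m then c j else v (j - m)
  have hz1 : ∀ j ≤ m, z j = c j := fun j hj => if_pos hj
  have hz2 : ∀ j, z (m + j) = v j := by
    intro j
    rcases Nat.eq_zero_or_pos j with rfl | hj
    · rw [Nat.add_zero, hz1 m le_rfl, hcm]
    · have : ¬ m + j ≤ m := by omega
      simp [z, this]
  refine ⟨m + (w.length - 1), z, ?_, by omega, ?_, ?_⟩
  · rw [hz1 0 (by omega), hc0]
  · intro j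
    have : m + (w.length - 1) + 1 - w.length + j = m + j := by omega
    rw [this, hz2]
    simp [v]
  · rw [Finset.prod_range_add]
    refine mul_pos ?_ ?_
    · rw [Finset.prod_congr rfl (g := fun j => P (c j) (c (j + 1)))]
      · exact hc
      · intro j hj
        have := Finset.mem_range.1 hj
        rw [hz1 j (by omega), hz1 (j + 1) (by omega)]
    · simpa only [Nat.add_assoc, hz2] using hv

/-- The expected waiting time for the next occurrence of a word is bounded, uniformly in the past. -/
lemma IsMarkovChain.exists_lintegral_waitTime_le (hY : IsMarkovChain μ P Y) (hP : P.IsIrreducible)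
    (h : Unnested U D) (hU : 0 < μ {ω | ∀ j : Fin U.length, Y j ω = U.get j}) :
    ∃ C : ℝ≥0∞, C < ∞ ∧ ∀ (k n : ℕ) (G : Set (ℕ → Δ)), Determined n G →
      (∀ y ∈ G, wordTime U D y k = n) →
      ∫⁻ ω in {ω | (fun i => Y i ω) ∈ G}, (waitTime U D (fun i => Y i ω) (k + 1) : ℝ≥0∞) ∂μ ≤
        C * μ {ω | (fun i => Y i ω) ∈ G} := by
  have hU0 : 0 < U.length := by simpa [word] using h.length_pos 1
  choose r z hz0 hr hz hpos using fun x => hY.exists_path_to_word hP hU0 hU x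
  obtain ⟨C, hC, hF⟩ := hY.exists_tsum_le_of_escape r z hz0 hpos
  refine ⟨1 + C, ENNReal.add_lt_top.2 ⟨ENNReal.one_lt_top, hC⟩, fun k n G hG hGn => ?_⟩
  let F : ℕ → Set (ℕ → Δ) := fun l =>
    G ∩ {y | ∀ t, n < t → t ≤ n + l + 1 → ∀ s, ¬ OccursAt (word U D s) y t}
  have hFdet : ∀ l, Determined (n + l + 1) (F l) := by
    refine fun l => (hG.mono (by omega)).inter fun y y' hyy hy t h1 h2 s hs => hy t h1 h2 s ?_
    exact hs.congr fun i hi => (hyy i (by omega)).symm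
  have hFanti : Antitone F := fun l l' hl y hy => ⟨hy.1, fun t h1 h2 => hy.2 t h1 (by omega)⟩
  have hFesc : ∀ l x y, y ∈ F l → (∀ j ≤ r x, y (n + l + j) = z x j) → y ∉ F (l + r x) := by
    intro l x y _ hyz hy
    refine hy.2 (n + l + r x + 1) (by omega) (by omega) 1 ?_
    have e : word U D 1 = U := by simp [word]
    rw [e]
    have := hr x
    refine ⟨by omega, fun j => ?_⟩
    rw [← hz x j, ← hyz _ (by omega)]
    congr 1
    omega
  have hFsum := hF n F hFdet hFanti hFesc
  have hGm : MeasurableSet {ω | (fun i => Y i ω) ∈ G} := hY.measurable_path hG.measurableSet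
  have hwm : Measurable fun ω => waitTime U D (fun i => Y i ω) (k + 1) :=
    measurable_waitTime.comp hY.measurable_path
  have hlm : ∀ l : ℕ, MeasurableSet {ω | (l : ℕ∞) < waitTime U D (fun i => Y i ω) (k + 1)} :=
    fun l => hwm (MeasurableSet.of_discrete (s := Set.Ioi (l : ℕ∞)))
  have hterm : ∀ l : ℕ, ∫⁻ ω in {ω | (fun i => Y i ω) ∈ G},
      (if (l : ℕ∞) < waitTime U D (fun i => Y i ω) (k + 1) then 1 else 0) ∂μ =
      μ ({ω | (l : ℕ∞) < waitTime U D (fun i => Y i ω) (k + 1)} ∩ {ω | (fun i => Y i ω) ∈ G}) := by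
    intro l
    rw [← Measure.restrict_apply (hlm l), ← lintegral_indicator_one (hlm l)]
    refine lintegral_congr fun ω => ?_
    simp [Set.indicator_apply]
  calc ∫⁻ ω in {ω | (fun i => Y i ω) ∈ G}, (waitTime U D (fun i => Y i ω) (k + 1) : ℝ≥0∞) ∂μ
      = ∑' l : ℕ, μ ({ω | (l : ℕ∞) < waitTime U D (fun i => Y i ω) (k + 1)} ∩
          {ω | (fun i => Y i ω) ∈ G}) := by
        simp only [← hterm]
        rw [← lintegral_tsum fun l => (Measurable.ite (hlm l) measurable_const
          measurable_const).aemeasurable]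
        exact lintegral_congr fun ω => enat_toENNReal_eq_tsum _
    _ ≤ μ {ω | (fun i => Y i ω) ∈ G} + C * μ {ω | (fun i => Y i ω) ∈ G} := by
        rw [tsum_eq_zero_add' ENNReal.summable]
        refine add_le_add (measure_mono Set.inter_subset_right) ?_
        refine le_trans (ENNReal.tsum_le_tsum fun l => measure_mono ?_)
          (hFsum.trans (mul_le_mul_right (measure_mono fun ω hω => hω.1) C))
        rintro ω ⟨hω, hωG⟩
        refine ⟨hωG, fun t ht1 ht2 s hs => ?_⟩
        have hlt : ((l + 1 : ℕ) : ℕ∞) < waitTime U D (fun i => Y i ω) (k + 1) := hω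
        unfold waitTime at hlt
        rw [Nat.add_sub_cancel, hGn _ hωG, lt_tsub_iff_left, ← Nat.cast_add, wordTime,
          lt_sInf_iff] at hlt
        refine hlt t (by omega) ⟨?_, occurs_iff.2 ⟨s, hs⟩⟩
        rw [hGn _ hωG]
        exact_mod_cast ht1
    _ = _ := by ring

/-- The renewal property: given the sign `Xₖ = s`, the next waiting time and the next sign are
distributed as `(γ₂, X₂)` given `X₁ = s`, whatever else happened before. -/
lemma IsMarkovChain.renewal (hY : IsMarkovChain μ P Y) (h : Unnested U D) {s : ℤˣ}
    (hs : 0 < μ (firstSign Y U D s)) {k : ℕ} {G : Set (ℕ → Δ)}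
    (hG : ∀ n, Determined n (G ∩ {y | wordTime U D y k = n})) (g : ℕ∞ × ℤ → ℝ≥0∞) :
    ∫⁻ ω in {ω | (fun i => Y i ω) ∈ G ∧ wordSign U D (fun i => Y i ω) k = s},
        g (waitTime U D (fun i => Y i ω) (k + 1), wordSign U D (fun i => Y i ω) (k + 1)) ∂μ =
      μ {ω | (fun i => Y i ω) ∈ G ∧ wordSign U D (fun i => Y i ω) k = s} *
        ∫⁻ ω, g (waitTime U D (fun i => Y i ω) 2, wordSign U D (fun i => Y i ω) 2)
          ∂μ[|firstSign Y U D s] := by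
  set w := word U D s with hw
  have hw0 : 0 < w.length := h.length_pos s
  -- Splitting by the value `n` of `τₖ` replaces the random time by fixed ones.
  let E : Set (ℕ → Δ) → ℕ → ℕ → Set (ℕ → Δ) := fun G k n =>
    (G ∩ {y | wordTime U D y k = n}) ∩ {y | OccursAt w y n}
  let f : ℕ → Ω → ℝ≥0∞ := fun k ω =>
    g (waitTime U D (fun i => Y i ω) (k + 1), wordSign U D (fun i => Y i ω) (k + 1))
  let Φ : (ℕ → Δ) → ℝ≥0∞ := fun z => g (waitTime U D (glue w z) 2, wordSign U D (glue w z) 2)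
  have hΦ : Measurable Φ := (Measurable.of_discrete (f := g)).comp
    ((measurable_waitTime.prodMk measurable_wordSign).comp (measurable_glue w))
  have hunion : ∀ (G : Set (ℕ → Δ)) (k : ℕ),
      {ω | (fun i => Y i ω) ∈ G ∧ wordSign U D (fun i => Y i ω) k = s} =
        ⋃ n, {ω | (fun i => Y i ω) ∈ E G k n} := by
    intro G k
    ext ω
    simp only [Set.mem_ofPred_eq, h.wordSign_eq_iff, Set.mem_iUnion, E, Set.mem_inter_iff]
    constructor
    · rintro ⟨h1, n, h2, h3⟩
      exact ⟨n, ⟨h1, h2⟩, h3⟩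
    · rintro ⟨n, ⟨h1, h2⟩, h3⟩
      exact ⟨h1, n, h2, h3⟩
  have hdisj : ∀ (G : Set (ℕ → Δ)) (k : ℕ),
      Pairwise (Function.onFun Disjoint fun n => {ω | (fun i => Y i ω) ∈ E G k n}) := by
    intro G k n n' hne
    refine Set.disjoint_left.2 fun ω h1 h2 => hne ?_
    exact_mod_cast h1.1.2.symm.trans h2.1.2
  have hdet : ∀ (G : Set (ℕ → Δ)) (k : ℕ), (∀ n, Determined n (G ∩ {y | wordTime U D y k = n})) →
      ∀ n, Determined n (E G k n) := fun G k hG n => (hG n).inter determined_occursAt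
  have hmeas : ∀ (G : Set (ℕ → Δ)) (k : ℕ), (∀ n, Determined n (G ∩ {y | wordTime U D y k = n})) →
      ∀ n, MeasurableSet {ω | (fun i => Y i ω) ∈ E G k n} :=
    fun G k hG n => hY.measurable_path (hdet G k hG n).measurableSet
  have hfΦ : ∀ (G : Set (ℕ → Δ)) (k : ℕ), (∀ n, Determined n (G ∩ {y | wordTime U D y k = n})) →
      ∀ n, ∫⁻ ω in {ω | (fun i => Y i ω) ∈ E G k n}, f k ω ∂μ =
        ∫⁻ ω in {ω | (fun i => Y i ω) ∈ E G k n}, Φ (fun i => Y (n - 1 + i) ω) ∂μ := by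
    intro G k hG n
    refine setLIntegral_congr_fun (hmeas G k hG n) fun ω hω => ?_
    have h1 := h.shift hω.1.2 hω.2
    have h2 := OccursAt.glue_eq (y := fun i => Y i ω) (n := n) hω.2 hw0
    simp only [Φ, f, h2, ← hw] at h1 ⊢
    rw [h1.1, h1.2]
  have huniv : ∀ n, Determined n ((Set.univ : Set (ℕ → Δ)) ∩ {y | wordTime U D y 1 = n}) := by
    intro n
    rw [Set.univ_inter]
    exact determined_wordTime
  have hlast : ∀ (G : Set (ℕ → Δ)) (k n : ℕ), ∀ y ∈ E G k (n + 1),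
      y n = w.get ⟨w.length - 1, by omega⟩ := by
    intro G k n y hy
    have h1 := hy.2.1
    rw [← hy.2.2 ⟨w.length - 1, by omega⟩]
    congr 1
    simp only
    omega
  -- Both pieces end in the last letter of `w`, so the Markov property compares them although they
  -- are read at different times. Summation over `n₁` and `n₂` then gives `htotal`.
  have hpiece : ∀ n₁ n₂, μ {ω | (fun i => Y i ω) ∈ E Set.univ 1 n₂} *
        ∫⁻ ω in {ω | (fun i => Y i ω) ∈ E G k n₁}, f k ω ∂μ =
      μ {ω | (fun i => Y i ω) ∈ E G k n₁} *
        ∫⁻ ω in {ω | (fun i => Y i ω) ∈ E Set.univ 1 n₂}, f 1 ω ∂μ := by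
    intro n₁ n₂
    have hzero : ∀ G k, {ω | (fun i => Y i ω) ∈ E G k 0} = ∅ := by
      intro G k
      ext ω
      simp only [Set.mem_ofPred_eq, Set.mem_empty_iff_false, iff_false]
      intro hc
      have := hc.2.1
      omega
    rw [hfΦ G k hG, hfΦ _ 1 huniv]
    rcases n₁ with _ | n₁
    · simp [hzero]
    rcases n₂ with _ | n₂
    · simp [hzero]
    exact hY.markov_property (hdet G k hG (n₁ + 1)) (hdet _ 1 huniv (n₂ + 1)) (hlast G k n₁)
      (hlast _ 1 n₂) hΦ
  have hfirst : firstSign Y U D s =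
      {ω | (fun i => Y i ω) ∈ Set.univ ∧ wordSign U D (fun i => Y i ω) 1 = s} := by
    simp [firstSign]
  have htotal : μ (firstSign Y U D s) *
        ∫⁻ ω in {ω | (fun i => Y i ω) ∈ G ∧ wordSign U D (fun i => Y i ω) k = s}, f k ω ∂μ =
      μ {ω | (fun i => Y i ω) ∈ G ∧ wordSign U D (fun i => Y i ω) k = s} *
        ∫⁻ ω in firstSign Y U D s, f 1 ω ∂μ := by
    rw [hfirst, hunion, hunion, lintegral_iUnion (hmeas G k hG) (hdisj G k),
      lintegral_iUnion (hmeas _ 1 huniv) (hdisj _ 1), measure_iUnion (hdisj G k) (hmeas G k hG),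
      measure_iUnion (hdisj _ 1) (hmeas _ 1 huniv), ← ENNReal.tsum_mul_right,
      ← ENNReal.tsum_mul_right]
    simp only [← ENNReal.tsum_mul_left, hpiece]
    exact ENNReal.tsum_comm
  rw [ProbabilityTheory.cond, lintegral_smul_measure, smul_eq_mul, ← mul_assoc, mul_comm (μ _),
    mul_assoc]
  change _ = (μ (firstSign Y U D s))⁻¹ * (_ * ∫⁻ ω in firstSign Y U D s, f 1 ω ∂μ)
  rw [← htotal, ← mul_assoc, ENNReal.inv_mul_cancel hs.ne' (measure_ne_top _ _), one_mul]

end Renewal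

/-- It lets the general lemmas on chains apply to the signs. -/
instance : DiscreteMeasurableSpace ℤˣ where
  forall_measurableSet s := ⟨Units.val '' s, MeasurableSet.of_discrete,
    Set.preimage_image_eq _ Units.val_injective⟩

/-! ### The process of signs -/

section Signs

variable {Ω Δ : Type*} {Y : ℕ → Ω → Δ} {U D : List Δ}

/-- The sequence of the signs, as a process with values in `{1, -1}`. -/
def signChain (Y : ℕ → Ω → Δ) (U D : List Δ) (k : ℕ) (ω : Ω) : ℤˣ :=
  if wordSign U D (fun i => Y i ω) (k + 1) = 1 then 1 else -1

/-- When all word times are finite, the default sign `0`, which `signChain` turns into `-1`, never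
arises. -/
lemma Unnested.coe_signChain (h : Unnested U D) {ω : Ω}
    (hω : ∀ k, wordTime U D (fun i => Y i ω) k ≠ ⊤) (k : ℕ) :
    (signChain Y U D k ω : ℤ) = wordSign U D (fun i => Y i ω) (k + 1) := by
  obtain ⟨n, hn⟩ := ENat.ne_top_iff_exists.1 (hω (k + 1))
  obtain ⟨s, hs, -⟩ := h.exists_wordSign hn.symm
  unfold signChain
  rw [hs]
  rcases Int.units_eq_one_or s with rfl | rfl <;> simp

/-- The signs up to `Xₖ` are settled at time `τₖ`; this is the hypothesis that `renewal` puts on the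
past. -/
lemma determined_wordSign_inter (k n : ℕ) (p : (ℕ → ℤ) → Prop)
    (hp : ∀ a b : ℕ → ℤ, (∀ j ≤ k, a j = b j) → p a → p b) :
    Determined n ({y : ℕ → Δ | p (wordSign U D y)} ∩ {y | wordTime U D y k = n}) := by
  intro y y' hyy hy
  exact ⟨hp _ _ (fun j hj => (wordSign_congr hyy hy.2 hj).symm) hy.1, wordTime_congr hyy hy.2⟩

end Signs

/-! ### The embedded chain -/

section Embedded

variable {Ω Δ : Type*} [MeasurableSpace Ω] {μ : Measure Ω} [IsProbabilityMeasure μ]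
  [Fintype Δ] [DecidableEq Δ] [MeasurableSpace Δ] [DiscreteMeasurableSpace Δ]
  {P : Matrix Δ Δ ℝ} {Y : ℕ → Ω → Δ} {U D : List Δ}

/-- On each event `τₖ = n` the next wait has a finite integral, hence is almost everywhere finite.
-/
lemma IsMarkovChain.ae_wordTime_ne_top (hY : IsMarkovChain μ P Y) (hP : P.IsIrreducible)
    (h : Unnested U D) (hU : 0 < μ {ω | ∀ j : Fin U.length, Y j ω = U.get j}) :
    ∀ᵐ ω ∂μ, ∀ k, wordTime U D (fun i => Y i ω) k ≠ ⊤ := by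
  obtain ⟨C, hC, hb⟩ := hY.exists_lintegral_waitTime_le hP h hU
  rw [ae_all_iff]
  intro k
  induction k with
  | zero => exact Filter.Eventually.of_forall fun ω => by simp [wordTime]
  | succ k ih =>
    have hn : ∀ n : ℕ, ∀ᵐ ω ∂μ, wordTime U D (fun i => Y i ω) k = n →
        wordTime U D (fun i => Y i ω) (k + 1) ≠ ⊤ := by
      intro n
      have hm : MeasurableSet {ω | (fun i => Y i ω) ∈ {y | wordTime U D y k = n}} :=
        hY.measurable_path (determined_wordTime (n := n) (k := k)).measurableSet
      have hlt := (hb k n {y | wordTime U D y k = n} determined_wordTime fun _ hy => hy).trans_lt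
        (ENNReal.mul_lt_top hC (measure_lt_top _ _))
      have hae := ae_lt_top ((Measurable.of_discrete (f := fun t : ℕ∞ => (t : ℝ≥0∞))).comp
        (measurable_waitTime.comp hY.measurable_path)) hlt.ne
      rw [ae_restrict_iff' hm] at hae
      filter_upwards [hae] with ω hω hk htop
      have := hω hk
      simp only [Function.comp, waitTime, htop, Nat.add_sub_cancel, hk] at this
      simp at this
    filter_upwards [ih, ae_all_iff.2 hn] with ω hω hω'
    obtain ⟨n, hn⟩ := ENat.ne_top_iff_exists.1 hω
    exact hω' n hn.symm

/-- The bound on the wait is uniform over the events `τ₁ = n`, so it survives summation over `n`. -/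
lemma IsMarkovChain.lintegral_waitTime_two_lt_top (hY : IsMarkovChain μ P Y)
    (hP : P.IsIrreducible) (h : Unnested U D)
    (hU : 0 < μ {ω | ∀ j : Fin U.length, Y j ω = U.get j}) {s : ℤˣ}
    (hs : 0 < μ (firstSign Y U D s)) :
    expectedTime μ[|firstSign Y U D s] (fun ω => waitTime U D (fun i => Y i ω) 2) < ∞ := by
  obtain ⟨C, hC, hb⟩ := hY.exists_lintegral_waitTime_le hP h hU
  unfold expectedTime
  rw [ProbabilityTheory.cond, lintegral_smul_measure, smul_eq_mul]
  refine ENNReal.mul_lt_top (by simpa using hs) ?_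
  let S : ℕ → Set Ω := fun n => {ω | wordTime U D (fun i => Y i ω) 1 = n}
  have hSm : ∀ n, MeasurableSet (S n) := fun n =>
    hY.measurable_path (determined_wordTime (n := n) (k := 1)).measurableSet
  have hdisj : Pairwise (Function.onFun Disjoint S) := by
    intro n n' hne
    refine Set.disjoint_left.2 fun ω h1 h2 => hne ?_
    exact_mod_cast h1.symm.trans h2
  have hsub : firstSign Y U D s ⊆ ⋃ n, S n := by
    intro ω hω
    obtain ⟨n, hn, -⟩ := h.wordSign_eq_iff.1 hω
    exact Set.mem_iUnion.2 ⟨n, hn⟩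
  calc _ ≤ ∫⁻ ω in ⋃ n, S n, (waitTime U D (fun i => Y i ω) 2 : ℝ≥0∞) ∂μ :=
        lintegral_mono_set hsub
    _ = ∑' n, ∫⁻ ω in S n, (waitTime U D (fun i => Y i ω) 2 : ℝ≥0∞) ∂μ :=
        lintegral_iUnion hSm hdisj _
    _ ≤ ∑' n, C * μ (S n) := ENNReal.tsum_le_tsum fun n =>
        hb 1 n {y | wordTime U D y 1 = n} determined_wordTime fun _ hy => hy
    _ = C * μ (⋃ n, S n) := by rw [ENNReal.tsum_mul_left, measure_iUnion hdisj hSm]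
    _ < ∞ := ENNReal.mul_lt_top hC (measure_lt_top _ _)

lemma IsMarkovChain.signChain_isMarkovChain (hY : IsMarkovChain μ P Y) (hP : P.IsIrreducible)
    (h : Unnested U D) (hU : 0 < μ {ω | ∀ j : Fin U.length, Y j ω = U.get j})
    (hs : ∀ s : ℤˣ, 0 < μ (firstSign Y U D s)) :
    IsMarkovChain μ (signMatrix μ Y U D) (signChain Y U D) := by
  have hae := hY.ae_wordTime_ne_top hP h hU
  have hsm : ∀ (k : ℕ) (s : ℤ), MeasurableSet {ω | wordSign U D (fun i => Y i ω) k = s} :=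
    fun k s => measurable_wordSign.comp hY.measurable_path (measurableSet_singleton s)
  have hiff : ∀ᵐ ω ∂μ, ∀ (k : ℕ) (s : ℤˣ),
      signChain Y U D k ω = s ↔ wordSign U D (fun i => Y i ω) (k + 1) = s := by
    filter_upwards [hae] with ω hω k s
    rw [← h.coe_signChain hω, Units.val_inj]
  refine ⟨fun k => Measurable.ite (hsm _ 1) measurable_const measurable_const, ?_, ?_⟩
  · rw [Matrix.mem_rowStochastic_iff_sum]
    refine ⟨fun i j => measureReal_nonneg, fun i => ?_⟩
    have : IsProbabilityMeasure μ[|firstSign Y U D i] := cond_isProbabilityMeasure (hs i).ne'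
    have hm2 : Measurable (signChain Y U D 1) :=
      Measurable.ite (hsm _ 1) measurable_const measurable_const
    have hsum := sum_measureReal_preimage_singleton (μ := μ[|firstSign Y U D i])
      (f := signChain Y U D 1) (Finset.univ : Finset ℤˣ)
      (fun s _ => hm2 (measurableSet_singleton s))
    simp only [Finset.coe_univ, Set.preimage_univ, probReal_univ] at hsum
    rw [← hsum]
    refine Finset.sum_congr rfl fun j _ => measureReal_congr ?_
    filter_upwards [cond_absolutelyContinuous.ae_le hiff] with ω hω
    exact propext (hω 1 j).symm
  · intro n x
    let G : Set (ℕ → Δ) := {y | ∀ i ≤ n, wordSign U D y (i + 1) = x i}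
    have hG : ∀ m, Determined m (G ∩ {y | wordTime U D y (n + 1) = m}) := fun m =>
      determined_wordSign_inter (n + 1) m (fun a => ∀ i ≤ n, a (i + 1) = x i)
        fun a b hab ha i hi => by rw [← hab _ (by omega), ha i hi]
    -- Renewal with the past signs as `G` and the indicator of the next sign as `g` is the Markov
    -- identity.
    have hren := hY.renewal h (hs (x n)) (k := n + 1) hG
      (fun p => if p.2 = x (n + 1) then 1 else 0)
    have hGm : MeasurableSet {ω | (fun i => Y i ω) ∈ G ∧
        wordSign U D (fun i => Y i ω) (n + 1) = x n} := by
      refine MeasurableSet.inter (measurableSet_setOfPred.2 ?_) (hsm _ _)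
      exact Measurable.forall fun i => Measurable.imp measurable_const
        (measurableSet_setOfPred.1 (hsm _ _))
    have hind : ∀ (ν : Measure Ω) (k : ℕ) (s : ℤ),
        ∫⁻ ω, (if wordSign U D (fun i => Y i ω) k = s then 1 else 0) ∂ν =
          ν {ω | wordSign U D (fun i => Y i ω) k = s} := by
      intro ν k s
      rw [← lintegral_indicator_one (hsm k s)]
      refine lintegral_congr fun ω => ?_
      simp [Set.indicator_apply]
    rw [hind, hind, Measure.restrict_apply (hsm _ _)] at hren
    have e1 : μ.real {ω | ∀ i ≤ n + 1, signChain Y U D i ω = x i} =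
        μ.real ({ω | wordSign U D (fun i => Y i ω) (n + 1 + 1) = x (n + 1)} ∩
          {ω | (fun i => Y i ω) ∈ G ∧ wordSign U D (fun i => Y i ω) (n + 1) = x n}) := by
      refine measureReal_congr ?_
      filter_upwards [hiff] with ω hω
      refine propext ⟨fun hx => ⟨?_, ?_, ?_⟩, fun hx i hi => ?_⟩
      · exact (hω _ _).1 (hx (n + 1) le_rfl)
      · exact fun i hi => (hω _ _).1 (hx i (by omega))
      · exact (hω _ _).1 (hx n (by omega))
      · rw [hω]
        rcases Nat.lt_or_ge n i with h1 | h1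
        · obtain rfl : i = n + 1 := by omega
          exact hx.1
        · exact hx.2.1 i h1
    have e2 : μ.real {ω | ∀ i ≤ n, signChain Y U D i ω = x i} =
        μ.real {ω | (fun i => Y i ω) ∈ G ∧ wordSign U D (fun i => Y i ω) (n + 1) = x n} := by
      refine measureReal_congr ?_
      filter_upwards [hiff] with ω hω
      refine propext ⟨fun hx => ⟨?_, ?_⟩, fun hx i hi => ?_⟩
      · exact fun i hi => (hω _ _).1 (hx i (by omega))
      · exact (hω _ _).1 (hx n (by omega))
      · exact (hω _ _).2 (hx.1 i hi)
    rw [e1, e2]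
    have := congrArg ENNReal.toReal hren
    rw [ENNReal.toReal_mul] at this
    exact this

end Embedded

/-! ### Ruin of a walk with Markovian signs -/

section Ruin

variable {Ω : Type*} [MeasurableSpace Ω] {μ : Measure Ω}

/-- An aperiodic stochastic matrix on two states leads from every state to one that can be held. -/
lemma exists_hold_of_isAperiodic {Q : Matrix ℤˣ ℤˣ ℝ} (hQ : Q ∈ Matrix.rowStochastic ℝ ℤˣ)
    (hap : IsAperiodic Q) (x : ℤˣ) : ∃ s, 0 < Q x s ∧ 0 < Q s s := by
  obtain ⟨h0, h1⟩ := Matrix.mem_rowStochastic_iff_sum.1 hQ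
  have hrow : ∀ s : ℤˣ, Q s s + Q s (-s) = 1 := by
    intro s
    rw [← h1 s]
    rcases Int.units_eq_one_or s with rfl | rfl
    · simp [UnitsInt.univ]
    · simp [UnitsInt.univ, add_comm]
  have hdiag : ∃ s, 0 < Q s s := by
    by_contra hc
    push Not at hc
    have hz : ∀ s, Q s s = 0 := fun s => le_antisymm (hc s) (h0 s s)
    have ho : ∀ s, Q s (-s) = 1 := fun s => by have := hrow s; rw [hz s] at this; linarith
    -- With zero diagonal the chain alternates, so returns take an even number of steps, against
    -- aperiodicity.
    have hsq : Q * Q = 1 := by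
      ext i j
      have h11 := hz 1
      have h22 := hz (-1)
      have h12 := ho 1
      have h21 := ho (-1)
      rw [neg_neg] at h21
      rw [Matrix.mul_apply, UnitsInt.univ]
      rcases Int.units_eq_one_or i with rfl | rfl <;> rcases Int.units_eq_one_or j with rfl | rfl <;>
        simp [h11, h22, h12, h21]
    have := hap 1 2 fun n _ hpos => by
      by_contra hodd
      obtain ⟨m, rfl⟩ : ∃ m, n = 2 * m + 1 := ⟨n / 2, by omega⟩
      rw [pow_succ, pow_mul, pow_two, hsq, one_pow, one_mul, hz] at hpos
      exact lt_irrefl _ hpos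
    omega
  obtain ⟨s, hs⟩ := hdiag
  by_cases hxs : x = s
  · exact ⟨s, by rwa [hxs], hs⟩
  · have hx : x = -s := by
      rcases Int.units_eq_one_or s with rfl | rfl <;> rcases Int.units_eq_one_or x with rfl | rfl <;>
        simp_all
    rcases (h0 x s).eq_or_lt with hz | hp
    · have := hrow x
      rw [hx, neg_neg, ← hx, ← hz] at this
      have hxx : 0 < Q x x := by linarith
      exact ⟨x, hxx, hxx⟩
    · exact ⟨s, hp, hs⟩

/-- A walk with Markovian steps `±1` leaves a bounded interval in finite expected time. -/
lemma IsMarkovChain.tsum_not_exit_lt_top [IsProbabilityMeasure μ] {Q : Matrix ℤˣ ℤˣ ℝ}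
    {X : ℕ → Ω → ℤˣ} (hX : IsMarkovChain μ Q X) (hap : IsAperiodic Q) {A B : ℤ} (hA : 0 < A)
    (hB : 0 < B) :
    ∑' k : ℕ, μ {ω | ∀ j ≤ k, ¬ (∑ i ∈ Finset.range (j + 1), (X i ω : ℤ) = A ∨
      ∑ i ∈ Finset.range (j + 1), (X i ω : ℤ) = -B)} < ∞ := by
  choose s hs1 hs2 using exists_hold_of_isAperiodic hX.stochastic hap
  let z : ℤˣ → ℕ → ℤˣ := fun x j => if j = 0 then x else s x
  -- From anywhere strictly between the barriers, `A + B` further equal steps lead out.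
  obtain ⟨C, hC, hF⟩ := hX.exists_tsum_le_of_escape (fun _ => (A + B).toNat) z (fun x => rfl)
    (fun x => Finset.prod_pos fun j _ => by
      rcases Nat.eq_zero_or_pos j with rfl | hj
      · exact hs1 x
      · simpa [z, hj.ne'] using hs2 x)
  let W : (ℕ → ℤˣ) → ℕ → ℤ := fun x j => ∑ i ∈ Finset.range j, (x i : ℤ)
  let F : ℕ → Set (ℕ → ℤˣ) := fun k => {x | ∀ j ≤ k, ¬ (W x (j + 1) = A ∨ W x (j + 1) = -B)}
  have hdet : ∀ k, Determined (0 + k + 1) (F k) := by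
    intro k x x' hxx hx j hj
    have : W x' (j + 1) = W x (j + 1) := Finset.sum_congr rfl fun i hi => by
      rw [hxx i (by have := Finset.mem_range.1 hi; omega)]
    rw [this]
    exact hx j hj
  have hbound : ∀ k, ∀ x ∈ F k, -B < W x (k + 1) ∧ W x (k + 1) < A := by
    intro k x hx
    refine walk_mem_Ioo hA hB (W := W x) (k := k + 1) (by simp [W]) ?_ ?_ (k + 1) le_rfl
    · intro j
      have e : W x (j + 1) = W x j + (x j : ℤ) := Finset.sum_range_succ _ _
      rcases Int.units_eq_one_or (x j) with h | h <;> rw [h] at e <;> push_cast at e <;> omega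
    · intro j hj1 hj2
      obtain ⟨i, rfl⟩ := Nat.exists_eq_add_of_le' hj1
      exact hx i (by omega)
  refine (hF 0 F hdet (fun k l hkl x hx j hj => hx j (hj.trans hkl)) ?_).trans_lt
    (ENNReal.mul_lt_top hC (measure_lt_top _ _))
  intro k x y hy hyz hy'
  have h1 := hbound _ _ hy
  have h2 := hbound _ _ hy'
  have h3 : ∀ r ≤ (A + B).toNat, W y (k + r + 1) = W y (k + 1) + r * (s x : ℤ) := by
    intro r
    induction r with
    | zero => simp
    | succ r ih =>
      intro hr
      have e : W y (k + (r + 1) + 1) = W y (k + r + 1) + (y (k + (r + 1)) : ℤ) :=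
        Finset.sum_range_succ _ _
      have e2 := hyz (r + 1) hr
      rw [Nat.zero_add] at e2
      rw [e, ih (by omega), e2]
      simp only [z, Nat.succ_ne_zero, if_false]
      push_cast
      ring
  rw [h3 _ le_rfl, Int.toNat_of_nonneg (by omega)] at h2
  rcases Int.units_eq_one_or (s x) with h | h <;> rw [h] at h2 <;> push_cast at h2 <;> omega

end Ruin

/-! ### Pathwise identities for `τ` and `T` -/

section Pathwise

variable {Δ : Type*} {U D : List Δ} {y : ℕ → Δ} {t : ℕ → ℕ} {A B : ℤ} {K : ℕ}

/-- The walk has not been stopped by its `(k + 1)`-st step, and this step is `s`. -/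
def ActiveStep (U D : List Δ) (A B : ℤ) (y : ℕ → Δ) (s : ℤ) (k : ℕ) : Prop :=
  ((k + 1 : ℕ) : ℕ∞) < ruinTime U D A B y ∧ wordSign U D y (k + 1) = s

open Classical in
lemma activeStep_add (h : Unnested U D) (ht : ∀ k, wordTime U D y k = t k) (f : ℕ → ℝ≥0∞) (k : ℕ) :
    (if ActiveStep U D A B y 1 k then f k else 0) + (if ActiveStep U D A B y (-1) k then f k else 0)
      = if ((k + 1 : ℕ) : ℕ∞) < ruinTime U D A B y then f k else 0 := by
  obtain ⟨s, hs, -⟩ := h.exists_wordSign (ht (k + 1))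
  unfold ActiveStep
  rw [hs]
  rcases Int.units_eq_one_or s with rfl | rfl <;> simp

lemma tsum_ite_lt_eq_sum (hK : ruinTime U D A B y = K) (f : ℕ → ℝ≥0∞) :
    ∑' k : ℕ, (if ((k + 1 : ℕ) : ℕ∞) < ruinTime U D A B y then f k else 0) =
      ∑ k ∈ Finset.range (K - 1), f k := by
  rw [hK, tsum_eq_sum (s := Finset.range (K - 1))]
  · refine Finset.sum_congr rfl fun k hk => if_pos ?_
    have := Finset.mem_range.1 hk
    exact_mod_cast (by omega : k + 1 < K)
  · intro k hk
    refine if_neg ?_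
    have : ¬ k < K - 1 := by simpa using hk
    exact_mod_cast (by omega : ¬ k + 1 < K)

open Classical in
lemma Unnested.gameTime_decomposition (h : Unnested U D) (ht : ∀ k, wordTime U D y k = t k)
    (hA : 0 < A) (hB : 0 < B) (hK : ruinTime U D A B y = K) :
    (gameTime U D A B y : ℝ≥0∞) = (waitTime U D y 1 : ℝ≥0∞) +
      (∑' k : ℕ, (if ActiveStep U D A B y 1 k then (waitTime U D y (k + 2) : ℝ≥0∞) else 0) +
       ∑' k : ℕ, (if ActiveStep U D A B y (-1) k then (waitTime U D y (k + 2) : ℝ≥0∞) else 0)) := by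
  rw [← ENNReal.tsum_add]
  simp only [activeStep_add h ht fun k => (waitTime U D y (k + 2) : ℝ≥0∞)]
  rw [tsum_ite_lt_eq_sum hK, h.gameTime_eq ht hA hB hK]
  have hK1 := (ruinTime_eq_iff.1 hK).1.1
  have hmono := strictMono_of_wordTime ht
  have hwait : ∀ k, waitTime U D y (k + 1) = ((t (k + 1) - t k : ℕ) : ℕ∞) := fun k => by
    have := hmono (show k < k + 1 by omega)
    rw [waitTime_succ_eq_iff (ht k), ht]
    congr 1
    omega
  have h0 : t 0 = 0 := by have := ht 0; rw [wordTime] at this; exact_mod_cast this.symm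
  have key : ∀ m, ((t (m + 1) : ℕ∞) : ℝ≥0∞) = (waitTime U D y 1 : ℝ≥0∞) +
      ∑ k ∈ Finset.range m, (waitTime U D y (k + 2) : ℝ≥0∞) := by
    intro m
    induction m with
    | zero => simp [hwait 0, h0]
    | succ m ih =>
      rw [Finset.sum_range_succ, ← add_assoc, ← ih, hwait (m + 1)]
      have := hmono (show m + 1 < m + 1 + 1 by omega)
      simp only [ENat.toENNReal_coe]
      exact_mod_cast (by omega : t (m + 1 + 1) = t (m + 1) + (t (m + 1 + 1) - t (m + 1)))
  have := key (K - 1)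
  rwa [Nat.sub_add_cancel hK1] at this

open Classical in
lemma Unnested.ruinTime_decomposition (h : Unnested U D) (ht : ∀ k, wordTime U D y k = t k)
    (hK : ruinTime U D A B y = K) :
    (ruinTime U D A B y : ℝ≥0∞) = 1 +
      (∑' k : ℕ, (if ActiveStep U D A B y 1 k then 1 else 0) +
       ∑' k : ℕ, (if ActiveStep U D A B y (-1) k then 1 else 0)) := by
  rw [← ENNReal.tsum_add]
  simp only [activeStep_add h ht fun _ => 1]
  rw [tsum_ite_lt_eq_sum hK, hK]
  have hK1 := (ruinTime_eq_iff.1 hK).1.1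
  simp only [Finset.sum_const, Finset.card_range, nsmul_eq_mul, mul_one, ENat.toENNReal_coe]
  exact_mod_cast (by omega : K = 1 + (K - 1))

open Classical in
/-- The balance of the steps `1` and `-1` before the last one. -/
lemma Unnested.activeStep_balance (h : Unnested U D) (ht : ∀ k, wordTime U D y k = t k)
    (hA : 0 < A) (hB : 0 < B) (hK : ruinTime U D A B y = K) :
    ∑' k : ℕ, (if ActiveStep U D A B y 1 k then (1 : ℝ≥0∞) else 0) +
        (if walk U D y K = A then 0 else ((B - 1).toNat : ℝ≥0∞)) =
      ∑' k : ℕ, (if ActiveStep U D A B y (-1) k then (1 : ℝ≥0∞) else 0) +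
        (if walk U D y K = A then ((A - 1).toNat : ℝ≥0∞) else 0) := by
  obtain ⟨⟨hK1, hK2⟩, hK3⟩ := ruinTime_eq_iff.1 hK
  have hsum : ∀ s : ℤ, ∑' k : ℕ, (if ActiveStep U D A B y s k then (1 : ℝ≥0∞) else 0) =
      ((∑ k ∈ Finset.range (K - 1), if wordSign U D y (k + 1) = s then 1 else 0 : ℕ) : ℝ≥0∞) := by
    intro s
    have e : ∀ k : ℕ, (if ActiveStep U D A B y s k then (1 : ℝ≥0∞) else 0) =
        if ((k + 1 : ℕ) : ℕ∞) < ruinTime U D A B y then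
          (if wordSign U D y (k + 1) = s then 1 else 0) else 0 := by
      intro k
      unfold ActiveStep
      by_cases h1 : ((k + 1 : ℕ) : ℕ∞) < ruinTime U D A B y <;>
        simp only [h1, true_and, false_and, if_true, if_false]
    simp only [e]
    rw [tsum_ite_lt_eq_sum hK]
    push_cast
    rfl
  have hsign : ∀ k, wordSign U D y (k + 1) = 1 ∨ wordSign U D y (k + 1) = -1 := by
    intro k
    obtain ⟨s, hs, -⟩ := h.exists_wordSign (ht (k + 1))
    rcases Int.units_eq_one_or s with rfl | rfl <;> simp [hs]
  have hwalk : ∀ m, ((∑ k ∈ Finset.range m, if wordSign U D y (k + 1) = 1 then 1 else 0 : ℕ) : ℤ) =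
      ((∑ k ∈ Finset.range m, if wordSign U D y (k + 1) = -1 then 1 else 0 : ℕ) : ℤ) +
        walk U D y m := by
    intro m
    induction m with
    | zero => simp [walk]
    | succ m ih =>
      rw [Finset.sum_range_succ, Finset.sum_range_succ, walk_succ]
      rcases hsign m with h | h
      · rw [h, if_pos rfl, if_neg (by decide)]
        push_cast at ih ⊢
        linarith
      · rw [h, if_pos rfl, if_neg (by decide)]
        push_cast at ih ⊢
        linarith
  -- Strictly inside one step before the end, the walk must stand at `A - 1` or `-(B - 1)`.
  have hb := walk_mem_Ioo hA hB (W := walk U D y) (k := K - 1) (by simp [walk])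
    (fun j => by rw [walk_succ]; rcases hsign j with h | h <;> rw [h] <;> omega)
    (fun j h1 h2 => fun hc => hK3 j (by omega) ⟨h1, hc⟩) (K - 1) le_rfl
  have hlast : walk U D y K = walk U D y (K - 1) + wordSign U D y K := by
    have := walk_succ (U := U) (D := D) (y := y) (k := K - 1)
    rwa [Nat.sub_add_cancel hK1] at this
  have hsK := hsign (K - 1)
  rw [Nat.sub_add_cancel hK1] at hsK
  have hw := hwalk (K - 1)
  rw [hsum, hsum]
  generalize (∑ k ∈ Finset.range (K - 1), if wordSign U D y (k + 1) = 1 then 1 else 0 : ℕ) = a at *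
  generalize (∑ k ∈ Finset.range (K - 1), if wordSign U D y (k + 1) = -1 then 1 else 0 : ℕ) = b at *
  split_ifs with hwin
  · rw [add_zero]
    exact_mod_cast (by omega : a = b + (A - 1).toNat)
  · rw [add_zero]
    exact_mod_cast (by omega : a + (B - 1).toNat = b)

end Pathwise

/-! ### Taking expectations -/

section Expectation

variable {Ω Δ : Type*} [MeasurableSpace Ω] {μ : Measure Ω}
  [Fintype Δ] [DecidableEq Δ] [MeasurableSpace Δ] [DiscreteMeasurableSpace Δ]
  {P : Matrix Δ Δ ℝ} {Y : ℕ → Ω → Δ} {U D : List Δ} {A B : ℤ}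

open Classical in
lemma lintegral_ite_const {α : Type*} [MeasurableSpace α] {ν : Measure α} {p : α → Prop}
    (hp : MeasurableSet {x | p x}) (c : ℝ≥0∞) :
    ∫⁻ x, (if p x then c else 0) ∂ν = c * ν {x | p x} := by
  rw [← lintegral_indicator_const hp]
  refine lintegral_congr fun x => ?_
  simp [Set.indicator_apply]

lemma IsMarkovChain.measurable_ruinTime (hY : IsMarkovChain μ P Y) :
    Measurable fun ω => ruinTime U D A B (fun i => Y i ω) :=
  TwoWordGame.measurable_ruinTime.comp hY.measurable_path

lemma IsMarkovChain.measurable_waitTime (hY : IsMarkovChain μ P Y) (k : ℕ) :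
    Measurable fun ω => (waitTime U D (fun i => Y i ω) k : ℝ≥0∞) :=
  (Measurable.of_discrete (f := fun t : ℕ∞ => (t : ℝ≥0∞))).comp
    (TwoWordGame.measurable_waitTime.comp hY.measurable_path)

lemma IsMarkovChain.measurableSet_activeStep (hY : IsMarkovChain μ P Y) (s : ℤ) (k : ℕ) :
    MeasurableSet {ω | ActiveStep U D A B (fun i => Y i ω) s k} :=
  (hY.measurable_ruinTime (MeasurableSet.of_discrete (s := Set.Ioi ((k + 1 : ℕ) : ℕ∞)))).inter
    ((measurable_wordSign.comp hY.measurable_path) (measurableSet_singleton s))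

variable [IsProbabilityMeasure μ]

lemma IsMarkovChain.expectedTime_ruinTime_lt_top (hY : IsMarkovChain μ P Y)
    (hP : P.IsIrreducible) (h : Unnested U D)
    (hU : 0 < μ {ω | ∀ j : Fin U.length, Y j ω = U.get j})
    (hs : ∀ s : ℤˣ, 0 < μ (firstSign Y U D s)) (hap : IsAperiodic (signMatrix μ Y U D))
    (hA : 0 < A) (hB : 0 < B) :
    expectedTime μ (fun ω => ruinTime U D A B (fun i => Y i ω)) < ∞ := by
  classical
  have hlm : ∀ l : ℕ, MeasurableSet {ω | (l : ℕ∞) < ruinTime U D A B (fun i => Y i ω)} :=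
    fun l => hY.measurable_ruinTime (MeasurableSet.of_discrete (s := Set.Ioi (l : ℕ∞)))
  have hsum : expectedTime μ (fun ω => ruinTime U D A B (fun i => Y i ω)) =
      ∑' l : ℕ, μ {ω | (l : ℕ∞) < ruinTime U D A B (fun i => Y i ω)} := by
    have e : ∀ l : ℕ, μ {ω | (l : ℕ∞) < ruinTime U D A B (fun i => Y i ω)} =
        ∫⁻ ω, (if (l : ℕ∞) < ruinTime U D A B (fun i => Y i ω) then 1 else 0) ∂μ := by
      intro l
      rw [← lintegral_indicator_one (hlm l)]
      refine lintegral_congr fun ω => ?_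
      simp [Set.indicator_apply]
    simp only [e]
    rw [← lintegral_tsum fun l => (Measurable.ite (hlm l) measurable_const
      measurable_const).aemeasurable]
    exact lintegral_congr fun ω => enat_toENNReal_eq_tsum _
  rw [hsum, tsum_eq_zero_add' ENNReal.summable]
  refine ENNReal.add_lt_top.2 ⟨measure_lt_top _ _, ?_⟩
  have hX := (hY.signChain_isMarkovChain hP h hU hs).tsum_not_exit_lt_top hap hA hB
  refine lt_of_le_of_lt (ENNReal.tsum_le_tsum fun k => measure_mono_ae ?_) hX
  filter_upwards [hY.ae_wordTime_ne_top hP h hU] with ω hω hlt j hj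
  have hw : ∀ m, walk U D (fun i => Y i ω) m =
      ∑ i ∈ Finset.range m, (signChain Y U D i ω : ℤ) := by
    intro m
    induction m with
    | zero => simp [walk]
    | succ m ih => rw [walk_succ, Finset.sum_range_succ, ih, h.coe_signChain hω]
  rw [← hw]
  intro hc
  exact lt_ruinTime_iff.1 hlt (j + 1) (by omega) ⟨by omega, hc⟩

/-- Survival past step `k + 1` depends only on the first `k + 1` signs, so `renewal` applies at
`τₖ₊₁`. -/
lemma IsMarkovChain.lintegral_activeStep (hY : IsMarkovChain μ P Y) (h : Unnested U D) {s : ℤˣ}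
    (hs : 0 < μ (firstSign Y U D s)) (k : ℕ) :
    ∫⁻ ω in {ω | ActiveStep U D A B (fun i => Y i ω) s k},
        (waitTime U D (fun i => Y i ω) (k + 2) : ℝ≥0∞) ∂μ =
      μ {ω | ActiveStep U D A B (fun i => Y i ω) s k} *
        expectedTime μ[|firstSign Y U D s] (fun ω => waitTime U D (fun i => Y i ω) 2) := by
  refine hY.renewal h hs (k := k + 1) (G := {y | ((k + 1 : ℕ) : ℕ∞) < ruinTime U D A B y})
    (fun n => ?_) (fun p => (p.1 : ℝ≥0∞))
  let p : (ℕ → ℤ) → Prop := fun a => ∀ j ≤ k + 1, ¬ (1 ≤ j ∧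
    (∑ i ∈ Finset.Icc 1 j, a i = A ∨ ∑ i ∈ Finset.Icc 1 j, a i = -B))
  have e : {y : ℕ → Δ | ((k + 1 : ℕ) : ℕ∞) < ruinTime U D A B y} = {y | p (wordSign U D y)} := by
    ext y
    exact lt_ruinTime_iff
  rw [e]
  refine determined_wordSign_inter (k + 1) n p fun a b hab ha j hj => ?_
  have : ∑ i ∈ Finset.Icc 1 j, b i = ∑ i ∈ Finset.Icc 1 j, a i :=
    Finset.sum_congr rfl fun i hi => (hab i ((Finset.mem_Icc.1 hi).2.trans hj)).symm
  rw [this]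
  exact ha j hj

/-- `c₁m₁ + c₂m₂ = (m₁ - m₂)/2 · (c₁ - c₂) + (m₁ + m₂)/2 · (c₁ + c₂)`, with the difference read off
from `hbal` and the sum from `hTc`. Finiteness of `T` makes the subtractions legitimate. -/
lemma expectedTime_eq_of_decomposition {m₁ m₂ c₁ c₂ g T : ℝ≥0∞} {α : ℝ} (hA : 0 < A) (hB : 0 < B)
    (hm₁ : m₁ < ∞) (hm₂ : m₂ < ∞) (hg : g < ∞) (hT : T < ∞) (hα0 : 0 ≤ α) (hα1 : α ≤ 1)
    (hTc : T = 1 + (c₁ + c₂))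
    (hbal : c₁ + ((B - 1).toNat : ℝ≥0∞) * ENNReal.ofReal (1 - α) =
      c₂ + ((A - 1).toNat : ℝ≥0∞) * ENNReal.ofReal α) :
    g + (c₁ * m₁ + c₂ * m₂) < ∞ ∧ (g + (c₁ * m₁ + c₂ * m₂)).toReal =
      g.toReal + (m₁.toReal - m₂.toReal) / 2 * ((A + B - 2) * α - (B - 1)) +
        (m₁.toReal + m₂.toReal) / 2 * (T.toReal - 1) := by
  have hc₁ : c₁ ≠ ∞ := by rintro rfl; simp [hTc] at hT
  have hc₂ : c₂ ≠ ∞ := by rintro rfl; simp [hTc] at hT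
  have hp₁ : c₁ * m₁ ≠ ∞ := ENNReal.mul_ne_top hc₁ hm₁.ne
  have hp₂ : c₂ * m₂ ≠ ∞ := ENNReal.mul_ne_top hc₂ hm₂.ne
  have hnat : ∀ n : ℕ, (n : ℝ≥0∞) ≠ ∞ := ENNReal.natCast_ne_top
  have hcast : ∀ a : ℤ, 0 < a → ((a - 1).toNat : ℝ) = (a : ℝ) - 1 := by
    intro a ha
    have : (((a - 1).toNat : ℤ) : ℝ) = ((a - 1 : ℤ) : ℝ) := by
      rw [Int.toNat_of_nonneg (by omega)]
    push_cast at this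
    exact this
  refine ⟨by simp [ENNReal.add_lt_top, hg, hp₁.lt_top, hp₂.lt_top], ?_⟩
  have hbal' := congrArg ENNReal.toReal hbal
  rw [ENNReal.toReal_add hc₁ (ENNReal.mul_ne_top (hnat _) ENNReal.ofReal_ne_top),
    ENNReal.toReal_add hc₂ (ENNReal.mul_ne_top (hnat _) ENNReal.ofReal_ne_top),
    ENNReal.toReal_mul, ENNReal.toReal_mul, ENNReal.toReal_natCast, ENNReal.toReal_natCast,
    ENNReal.toReal_ofReal (by linarith), ENNReal.toReal_ofReal hα0, hcast A hA, hcast B hB] at hbal'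
  rw [hTc, ENNReal.toReal_add hg.ne (ENNReal.add_ne_top.2 ⟨hp₁, hp₂⟩), ENNReal.toReal_add hp₁ hp₂,
    ENNReal.toReal_add ENNReal.one_ne_top (ENNReal.add_ne_top.2 ⟨hc₁, hc₂⟩),
    ENNReal.toReal_add hc₁ hc₂, ENNReal.toReal_mul, ENNReal.toReal_mul, ENNReal.toReal_one]
  linear_combination (m₁.toReal - m₂.toReal) / 2 * hbal'

end Expectation

end TwoWordGame

end

/-! ### Assembly of the formula -/

theorem mainTheorem2 {Ω Δ : Type*} [MeasurableSpace Ω] (μ : MeasureTheory.Measure Ω)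
    [MeasureTheory.IsProbabilityMeasure μ] [Fintype Δ] [DecidableEq Δ]
    [MeasurableSpace Δ] [DiscreteMeasurableSpace Δ]
    (P : Matrix Δ Δ ℝ) (Y : ℕ → Ω → Δ)
    (hY : TwoWordGame.IsMarkovChain μ P Y) (hP : P.IsIrreducible)
    (U D : List Δ) (hUD : ¬ U <:+: D) (hDU : ¬ D <:+: U)
    (hU : 0 < μ {ω | ∀ j : Fin U.length, Y j ω = U.get j})
    (hD : 0 < μ {ω | ∀ j : Fin D.length, Y j ω = D.get j})
    (A B : ℤ) (hA : 0 < A) (hB : 0 < B)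
    (haper : TwoWordGame.IsAperiodic (TwoWordGame.signMatrix μ Y U D)) :
    let Eτ : ℝ≥0∞ := TwoWordGame.expectedTime μ
      fun ω => TwoWordGame.gameTime U D A B (fun i => Y i ω)
    let ET : ℝ≥0∞ := TwoWordGame.expectedTime μ
      fun ω => TwoWordGame.ruinTime U D A B (fun i => Y i ω)
    let Eγ₁ : ℝ≥0∞ := TwoWordGame.expectedTime μ
      fun ω => TwoWordGame.waitTime U D (fun i => Y i ω) 1
    -- the conditional expectations of `γ₂` given `X₁ = s`
    let Eγ₂ : ℤ → ℝ≥0∞ := fun s => TwoWordGame.expectedTime (μ[|TwoWordGame.firstSign Y U D s])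
      fun ω => TwoWordGame.waitTime U D (fun i => Y i ω) 2
    let α : ℝ := TwoWordGame.winProb μ Y U D A B
    let a : ℝ := ((Eγ₂ 1).toReal - (Eγ₂ (-1)).toReal) / 2
    let b : ℝ := ((Eγ₂ 1).toReal + (Eγ₂ (-1)).toReal) / 2
    0 < μ (TwoWordGame.firstSign Y U D 1) ∧ 0 < μ (TwoWordGame.firstSign Y U D (-1)) ∧
    Eτ < ∞ ∧ ET < ∞ ∧ Eγ₁ < ∞ ∧ Eγ₂ 1 < ∞ ∧ Eγ₂ (-1) < ∞ ∧
    Eτ.toReal = Eγ₁.toReal + a * ((A + B - 2) * α - (B - 1)) + b * (ET.toReal - 1) := by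
  classical
  open TwoWordGame in
  intro Eτ ET Eγ₁ Eγ₂ α a b
  have h : Unnested U D := unnested_of_not_infix hUD hDU
  have hs : ∀ s : ℤˣ, 0 < μ (firstSign Y U D s) := by
    intro s
    refine h.firstSign_pos s ?_
    rcases Int.units_eq_one_or s with rfl | rfl
    · have e : word U D 1 = U := by simp [word]
      rwa [e]
    · have e : word U D (-1) = D := by simp [word]
      rwa [e]
  have hs1 : 0 < μ (firstSign Y U D 1) := by simpa using hs 1
  have hs2 : 0 < μ (firstSign Y U D (-1)) := by simpa using hs (-1)
  have hET : ET < ∞ := hY.expectedTime_ruinTime_lt_top hP h hU hs haper hA hB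
  have hγ₁ : Eγ₁ < ∞ := by
    obtain ⟨C, hC, hb⟩ := hY.exists_lintegral_waitTime_le hP h hU
    have := hb 0 0 Set.univ (fun _ _ _ _ => trivial) (fun _ _ => rfl)
    simp only [Set.mem_univ, Set.ofPred_true, Measure.restrict_univ, measure_univ, mul_one] at this
    exact this.trans_lt hC
  have hγ₂ : ∀ s : ℤˣ, Eγ₂ s < ∞ := fun s => hY.lintegral_waitTime_two_lt_top hP h hU (hs s)
  have hm1 : Eγ₂ 1 < ∞ := by simpa using hγ₂ 1
  have hm2 : Eγ₂ (-1) < ∞ := by simpa using hγ₂ (-1)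
  let S : ℤ → ℕ → Set Ω := fun s k => {ω | ActiveStep U D A B (fun i => Y i ω) s k}
  have hSm : ∀ s k, MeasurableSet (S s k) := hY.measurableSet_activeStep
  let c : ℤ → ℝ≥0∞ := fun s => ∑' k, μ (S s k)
  have hgood : ∀ᵐ ω ∂μ, ∃ (t : ℕ → ℕ) (K : ℕ), (∀ k, wordTime U D (fun i => Y i ω) k = t k) ∧
      ruinTime U D A B (fun i => Y i ω) = K := by
    have hT := ae_lt_top ((Measurable.of_discrete (f := fun t : ℕ∞ => (t : ℝ≥0∞))).comp
      hY.measurable_ruinTime) hET.ne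
    filter_upwards [hY.ae_wordTime_ne_top hP h hU, hT] with ω h1 h2
    choose t ht using fun k => ENat.ne_top_iff_exists.1 (h1 k)
    have h3 : ruinTime U D A B (fun i => Y i ω) ≠ ⊤ := by
      intro hc
      simp [hc] at h2
    obtain ⟨K, hK⟩ := ENat.ne_top_iff_exists.1 h3
    exact ⟨t, K, fun k => (ht k).symm, hK.symm⟩
  let V : Set Ω := {ω | ∃ K : ℕ, ruinTime U D A B (fun i => Y i ω) = K ∧
    walk U D (fun i => Y i ω) K = A}
  have hVm : MeasurableSet V := by
    have : V = ⋃ K : ℕ, {ω | ruinTime U D A B (fun i => Y i ω) = K} ∩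
        {ω | walk U D (fun i => Y i ω) K = A} := by
      ext ω
      simp [V]
    rw [this]
    exact MeasurableSet.iUnion fun K => (hY.measurable_ruinTime (measurableSet_singleton _)).inter
      ((measurable_walk.comp hY.measurable_path) (measurableSet_singleton A))
  -- Almost surely the game is won exactly when the walk is ruined at `A`.
  have hα : α = μ.real V := by
    refine measureReal_congr ?_
    filter_upwards [hgood] with ω ⟨t, K, ht, hK⟩
    have hg := h.gameTime_eq ht hA hB hK
    have hsc := h.score_wordTime ht K
    refine propext ⟨?_, ?_⟩
    · rintro ⟨n, hn, hnA⟩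
      obtain rfl : t K = n := by exact_mod_cast hg.symm.trans hn
      exact ⟨K, hK, hsc.symm.trans hnA⟩
    · rintro ⟨K', hK', hKA⟩
      obtain rfl : K = K' := by exact_mod_cast hK.symm.trans hK'
      exact ⟨t K, hg, hsc.trans hKA⟩
  have hτ : Eτ = Eγ₁ + (c 1 * Eγ₂ 1 + c (-1) * Eγ₂ (-1)) := by
    have hstep : ∀ s : ℤˣ, ∫⁻ ω, ∑' k : ℕ, (if ActiveStep U D A B (fun i => Y i ω) s k then
        (waitTime U D (fun i => Y i ω) (k + 2) : ℝ≥0∞) else 0) ∂μ = c s * Eγ₂ s := by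
      intro s
      rw [lintegral_tsum fun k => (Measurable.ite (hSm s k) (hY.measurable_waitTime _)
        measurable_const).aemeasurable, ← ENNReal.tsum_mul_right]
      refine tsum_congr fun k => ?_
      rw [← hY.lintegral_activeStep h (hs s) k, ← lintegral_indicator (hSm s k)]
      refine lintegral_congr fun ω => ?_
      simp [Set.indicator_apply, S]
    have h1 := hstep 1
    have h2 := hstep (-1)
    simp only [Units.val_one, Units.val_neg] at h1 h2
    rw [← h1, ← h2, ← lintegral_add_left]
    · change _ = ∫⁻ _, _ ∂μ + _
      rw [← lintegral_add_left (hY.measurable_waitTime 1)]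
      refine lintegral_congr_ae ?_
      filter_upwards [hgood] with ω ⟨t, K, ht, hK⟩
      exact h.gameTime_decomposition ht hA hB hK
    · exact Measurable.tsum fun k => Measurable.ite (hSm 1 k) (hY.measurable_waitTime _)
        measurable_const
  have hcount : ∀ s : ℤ, ∫⁻ ω, ∑' k : ℕ,
      (if ActiveStep U D A B (fun i => Y i ω) s k then 1 else 0) ∂μ = c s := by
    intro s
    rw [lintegral_tsum fun k => (Measurable.ite (hSm s k) measurable_const
      measurable_const).aemeasurable]
    refine tsum_congr fun k => ?_
    rw [lintegral_ite_const (hSm s k), one_mul]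
  have hcm : ∀ s : ℤ, Measurable fun ω => ∑' k : ℕ,
      (if ActiveStep U D A B (fun i => Y i ω) s k then (1 : ℝ≥0∞) else 0) :=
    fun s => Measurable.tsum fun k => Measurable.ite (hSm s k) measurable_const
      measurable_const
  have hT : ET = 1 + (c 1 + c (-1)) := by
    rw [← hcount, ← hcount, ← lintegral_add_left (hcm 1)]
    have e1 : (1 : ℝ≥0∞) = ∫⁻ _, 1 ∂μ := by simp
    rw [e1, ← lintegral_add_left measurable_const]
    refine lintegral_congr_ae ?_
    filter_upwards [hgood] with ω ⟨t, K, ht, hK⟩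
    simpa using h.ruinTime_decomposition ht hK
  -- The integrated form of `activeStep_balance`, with no subtraction in `ℝ≥0∞`.
  have hbal : c 1 + ((B - 1).toNat : ℝ≥0∞) * ENNReal.ofReal (1 - α) =
      c (-1) + ((A - 1).toNat : ℝ≥0∞) * ENNReal.ofReal α := by
    have e1 : ENNReal.ofReal (1 - α) = μ {ω | ω ∉ V} := by
      rw [hα, ← probReal_compl_eq_one_sub hVm, ofReal_measureReal]
      rfl
    have e2 : ENNReal.ofReal α = μ {ω | ω ∈ V} := by
      rw [hα, ofReal_measureReal]
      rfl
    rw [e1, e2, ← lintegral_ite_const (p := fun ω => ω ∉ V) hVm.compl,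
      ← lintegral_ite_const (p := fun ω => ω ∈ V) hVm, ← hcount, ← hcount,
      ← lintegral_add_left (hcm 1), ← lintegral_add_left (hcm (-1))]
    refine lintegral_congr_ae ?_
    filter_upwards [hgood] with ω ⟨t, K, ht, hK⟩
    have hV : ω ∈ V ↔ walk U D (fun i => Y i ω) K = A := by
      refine ⟨?_, fun hc => ⟨K, hK, hc⟩⟩
      rintro ⟨K', hK', hKA⟩
      obtain rfl : K = K' := by exact_mod_cast hK.symm.trans hK'
      exact hKA
    have := h.activeStep_balance ht hA hB hK
    simp only [← hV] at this
    by_cases hc : ω ∈ V <;>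
      simpa only [hc, not_true_eq_false, not_false_eq_true, if_true, if_false] using this
  have hfin := expectedTime_eq_of_decomposition hA hB hm1 hm2 hγ₁ hET
    (hα ▸ measureReal_nonneg) (hα ▸ measureReal_le_one) hT hbal
  rw [← hτ] at hfin
  exact ⟨hs1, hs2, hfin.1, hET, hγ₁, hm1, hm2, hfin.2⟩
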